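/- In the fair $k$-center problem one is given a universe $\mathcal U$ of $n$ points with a pseudometric $d$, a partition $\mathcal U=\mathcal U_1\cup\dots\cup\mathcal U_m$ into $m$ pairwise disjoint classes, and non-negative integers $k_1,\dots,k_m$ with $k=k_1+\dots+k_m\ge 1$. A set $S\subseteq\mathcal U$ is \emph{fair} if $|S\cap\mathcal U_i|=k_i$ for all $i$, and its clustering radius is $r(S)=\max_{u\in\mathcal U}\min_{s\in S}d(u,s)$. The goal is to find a fair set of minimum radius. There is a 3-approximation algorithm for this problem with running time $O(kn+m^2k^2\log k)$. That is, there are a single program for a unit-cost random access machine (with natural-number and real memory, addition, subtraction, comparison and indirect addressing, halving of natural numbers, no multiplication, and distance queries $d(u,v)$ in unit time) and an absolute constant $C$ such that on every instance that has at least one fair set the program, given $n,m,k$, the class of each point and the numbers $k_i$, halts after at most $C\,(kn+m^2k^2\log k)$ steps and outputs a fair set $S$ with $r(S)\le 3\,r(T)$ for every fair set $T$. -/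

import Mathlib

namespace FairKCenter

/-! ### The fair `k`-center problem -/

/-- An instance: a universe of `n` points with a pseudometric, each point in exactly one of `m`
classes (the fibres of `color`), and the required number `quota i` of centers of class `i`. -/
structure Problem where
  n : ℕ
  m : ℕ
  color : Fin n → Fin m
  quota : Fin m → ℕ
  dist : Fin n → Fin n → ℝ
  dist_nonneg : ∀ u v, 0 ≤ dist u v
  dist_self : ∀ u, dist u u = 0
  dist_comm : ∀ u v, dist u v = dist v u
  dist_triangle : ∀ u v w, dist u v ≤ dist u w + dist w v

namespace Problem

/-- The total number of centers. -/
def k (I : Problem) : ℕ := ∑ i, I.quota i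

/-- `S` contains exactly `quota i` points of each class `i`. -/
def IsFair (I : Problem) (S : Finset (Fin I.n)) : Prop :=
  ∀ i, (S.filter fun u => I.color u = i).card = I.quota i

/-- The clustering radius `max_u min_{s ∈ S} d(u, s)` (used for nonempty `S` only). -/
noncomputable def radius (I : Problem) (S : Finset (Fin I.n)) : ℝ :=
  ⨆ u : Fin I.n, ⨅ s : S, I.dist u s

/-- `S` is a fair set of centers whose radius is at most `α` times that of every fair set. -/
def IsApprox (I : Problem) (α : ℝ) (S : Finset (Fin I.n)) : Prop :=
  I.IsFair S ∧ ∀ T, I.IsFair T → I.radius S ≤ α * I.radius T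

end Problem

/-! ### A random access machine with distance queries

Programs are finite and structured. The memory consists of natural number registers, natural number
arrays, real registers and real arrays; a program can name only finitely many registers and arrays,
and array cells are addressed indirectly. Every elementary operation takes one unit of time: on
natural numbers, addition, truncated subtraction, halving and comparison (there is no
multiplication, so a step adds at most one bit to the length of the numbers in memory); on real
numbers, addition, subtraction and comparison; reading or writing a register or an array cell;
querying the distance of two points, which are referred to by their indices. There is no
conversion between real and natural numbers. -/

structure State where
  nreg : ℕ → ℕ
  narr : ℕ → ℕ → ℕ
  rreg : ℕ → ℝ
  rarr : ℕ → ℕ → ℝ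

/-- Expressions with values in the natural numbers. -/
inductive NExp where
  | const (c : ℕ)
  | reg (x : ℕ)
  | arr (a : ℕ) (idx : NExp)
  | add (e f : NExp)
  | sub (e f : NExp)
  | half (e : NExp)

def NExp.eval (s : State) : NExp → ℕ
  | const c => c
  | reg x => s.nreg x
  | arr a idx => s.narr a (idx.eval s)
  | add e f => e.eval s + f.eval s
  | sub e f => e.eval s - f.eval s
  | half e => e.eval s / 2

def NExp.cost : NExp → ℕ
  | const _ => 1
  | reg _ => 1
  | arr _ idx => idx.cost + 1
  | add e f => e.cost + f.cost + 1
  | sub e f => e.cost + f.cost + 1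
  | half e => e.cost + 1

/-- Expressions with values in the real numbers. -/
inductive RExp where
  | reg (x : ℕ)
  | arr (a : ℕ) (idx : NExp)
  | dist (p q : NExp)
  | add (e f : RExp)
  | sub (e f : RExp)

/-- `d` is the distance oracle. -/
noncomputable def RExp.eval (d : ℕ → ℕ → ℝ) (s : State) : RExp → ℝ
  | reg x => s.rreg x
  | arr a idx => s.rarr a (idx.eval s)
  | dist p q => d (p.eval s) (q.eval s)
  | add e f => e.eval d s + f.eval d s
  | sub e f => e.eval d s - f.eval d s

def RExp.cost : RExp → ℕ
  | reg _ => 1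
  | arr _ idx => idx.cost + 1
  | dist p q => p.cost + q.cost + 1
  | add e f => e.cost + f.cost + 1
  | sub e f => e.cost + f.cost + 1

/-- Tests. -/
inductive BExp where
  | nle (e f : NExp)
  | rle (e f : RExp)
  | not (b : BExp)
  | and (b c : BExp)

def BExp.eval (d : ℕ → ℕ → ℝ) (s : State) : BExp → Prop
  | nle e f => e.eval s ≤ f.eval s
  | rle e f => e.eval d s ≤ f.eval d s
  | not b => ¬ b.eval d s
  | and b c => b.eval d s ∧ c.eval d s

def BExp.cost : BExp → ℕ
  | nle e f => e.cost + f.cost + 1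
  | rle e f => e.cost + f.cost + 1
  | not b => b.cost + 1
  | and b c => b.cost + c.cost + 1

/-- Programs. -/
inductive Prog where
  | skip
  | nset (x : ℕ) (e : NExp)
  | nstore (a : ℕ) (idx e : NExp)
  | rset (x : ℕ) (e : RExp)
  | rstore (a : ℕ) (idx : NExp) (e : RExp)
  | seq (P Q : Prog)
  | ite (b : BExp) (P Q : Prog)
  | loop (b : BExp) (P : Prog)

/-- `Exec d P s t s'`: started in memory state `s` with distance oracle `d`, the program `P` halts
after exactly `t` units of time in state `s'`. Here `loop b P` is "while `b` do `P`". -/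
inductive Exec (d : ℕ → ℕ → ℝ) : Prog → State → ℕ → State → Prop where
  | skip (s : State) : Exec d .skip s 1 s
  | nset (s : State) (x : ℕ) (e : NExp) :
      Exec d (.nset x e) s (e.cost + 1)
        { s with nreg := Function.update s.nreg x (e.eval s) }
  | nstore (s : State) (a : ℕ) (idx e : NExp) :
      Exec d (.nstore a idx e) s (idx.cost + e.cost + 1)
        { s with narr := Function.update s.narr a
                  (Function.update (s.narr a) (idx.eval s) (e.eval s)) }
  | rset (s : State) (x : ℕ) (e : RExp) :
      Exec d (.rset x e) s (e.cost + 1)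
        { s with rreg := Function.update s.rreg x (e.eval d s) }
  | rstore (s : State) (a : ℕ) (idx : NExp) (e : RExp) :
      Exec d (.rstore a idx e) s (idx.cost + e.cost + 1)
        { s with rarr := Function.update s.rarr a
                  (Function.update (s.rarr a) (idx.eval s) (e.eval d s)) }
  | seq {P Q : Prog} {s s' s'' : State} {t t' : ℕ} :
      Exec d P s t s' → Exec d Q s' t' s'' → Exec d (.seq P Q) s (t + t') s''
  | ite_true {b : BExp} {P Q : Prog} {s s' : State} {t : ℕ} :
      b.eval d s → Exec d P s t s' → Exec d (.ite b P Q) s (b.cost + t) s'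
  | ite_false {b : BExp} {P Q : Prog} {s s' : State} {t : ℕ} :
      ¬ b.eval d s → Exec d Q s t s' → Exec d (.ite b P Q) s (b.cost + t) s'
  | loop_true {b : BExp} {P : Prog} {s s' s'' : State} {t t' : ℕ} :
      b.eval d s → Exec d P s t s' → Exec d (.loop b P) s' t' s'' →
      Exec d (.loop b P) s (b.cost + t + t') s''
  | loop_false {b : BExp} {P : Prog} {s : State} :
      ¬ b.eval d s → Exec d (.loop b P) s b.cost s

/-! ### Input and output -/

/-- The distance oracle of an instance (zero for indices that are not points). -/
noncomputable def Problem.oracle (I : Problem) (p q : ℕ) : ℝ :=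
  if h : p < I.n ∧ q < I.n then I.dist ⟨p, h.1⟩ ⟨q, h.2⟩ else 0

/-- The initial memory: registers `0, 1, 2` hold `n, m, k`, array `0` holds the class of each
point, array `1` the quota of each class, and everything else is zero. -/
def Problem.input (I : Problem) : State where
  nreg x := if x = 0 then I.n else if x = 1 then I.m else if x = 2 then I.k else 0
  narr a j :=
    if a = 0 then (if h : j < I.n then (I.color ⟨j, h⟩ : ℕ) else 0)
    else if a = 1 then (if h : j < I.m then I.quota ⟨j, h⟩ else 0)
    else 0
  rreg _ := 0
  rarr _ _ := 0

/-- The memory state `s` presents the set `S` of points as output: the first `k` cells of array `2`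
are the indices of the elements of `S`. -/
def Problem.Outputs (I : Problem) (s : State) (S : Finset (Fin I.n)) : Prop :=
  (Finset.range I.k).image (s.narr 2) = S.map Fin.valEmbedding

/-- On the instance `I`, the program `P` halts within time `T` and outputs an `α`-approximate
solution. -/
def Problem.SolvedBy (I : Problem) (P : Prog) (α T : ℝ) : Prop :=
  ∃ (t : ℕ) (s : State) (S : Finset (Fin I.n)),
    Exec I.oracle P I.input t s ∧ (t : ℝ) ≤ T ∧ I.Outputs s S ∧ I.IsApprox α S

end FairKCenter

namespace FairKCenter

/-! ### Program logic -/

/-! Pivots are chosen greedily, each one farthest from those before it, and every pivot is matched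
to a point of some class, with at most `quota i` pivots matched into class `i`. Two properties are
wanted: each pivot is within `r` of its matched point, and every point is within `2 * r` of a pivot.
Both must hold for every radius `r` achieved by a fair set, so that the optimum never has to be
known. The triangle inequality then gives the factor 3 (`Cover.approx`). Filling up the matched
points greedily reaches all quotas because some fair set exists (`completeProg_spec`).

The next pivot is matched by an augmenting path. From each pivot only the edge to the nearest point
of each class is kept. Starting from the new pivot, the search always follows the shortest edge from
a pivot of a reached class to an unreached class, until it meets a class with a free place. Let `ρ`
be the distance of the new pivot from the earlier ones; all pivots are then at mutual distance at
least `ρ`, and every point is within `ρ` of an earlier pivot. If `2 * r < ρ`, distinct pivots need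
distinct centers. As the reached classes are full, their pivots together with the new one outnumber
the centers available in these classes, so an edge of length at most `r` leaves them
(`Cover.exists_near`).

Hence the test "twice the shortest edge exceeds `ρ`" needs no guess of `r`
(`MainInv.shortest_edge`). If it succeeds, `ρ ≤ 2 * r` for every feasible `r`, and the earlier
pivots already cover within `2 * r`. If it fails, the edge is at most `r`: either because `2 * r <
ρ`, or because it is at most `ρ / 2 ≤ r`. If no search gives up, `k` pivots are matched, and
pigeonhole on `k + 1` separated points yields the cover (`Cover.not_separated`).

There are at most `k` searches, each with at most `m + 1` scans of at most `k * m` edges, and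
updating the distances costs `O(n)` per pivot. The total is `O(k n + m² k²)`, so the logarithm is
not needed when `k ≥ 2`. For `k = 1` it vanishes, and any fair singleton is already a
2-approximation. -/

/-- Started in `s`, the program `P` halts within time `T` in a state that satisfies `Q`. -/
def Run (d : ℕ → ℕ → ℝ) (P : Prog) (s : State) (T : ℕ) (Q : State → Prop) : Prop :=
  ∃ t s', Exec d P s t s' ∧ t ≤ T ∧ Q s'

/-- `P` may write natural number register `x`. -/
def Prog.writesNReg (x : ℕ) : Prog → Bool
  | nset y _ => x == y
  | seq P Q => P.writesNReg x || Q.writesNReg x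
  | ite _ P Q => P.writesNReg x || Q.writesNReg x
  | loop _ P => P.writesNReg x
  | _ => false

/-- `P` may write natural number array `x`. -/
def Prog.writesNArr (x : ℕ) : Prog → Bool
  | nstore y _ _ => x == y
  | seq P Q => P.writesNArr x || Q.writesNArr x
  | ite _ P Q => P.writesNArr x || Q.writesNArr x
  | loop _ P => P.writesNArr x
  | _ => false

/-- `P` may write real register `x`. -/
def Prog.writesRReg (x : ℕ) : Prog → Bool
  | rset y _ => x == y
  | seq P Q => P.writesRReg x || Q.writesRReg x
  | ite _ P Q => P.writesRReg x || Q.writesRReg x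
  | loop _ P => P.writesRReg x
  | _ => false

/-- `P` may write real array `x`. -/
def Prog.writesRArr (x : ℕ) : Prog → Bool
  | rstore y _ _ => x == y
  | seq P Q => P.writesRArr x || Q.writesRArr x
  | ite _ P Q => P.writesRArr x || Q.writesRArr x
  | loop _ P => P.writesRArr x
  | _ => false

/-- `s` and `s'` agree on the memory that `P` does not write. -/
structure Frame (P : Prog) (s s' : State) : Prop where
  nreg : ∀ x, P.writesNReg x = false → s'.nreg x = s.nreg x
  narr : ∀ x, P.writesNArr x = false → s'.narr x = s.narr x
  rreg : ∀ x, P.writesRReg x = false → s'.rreg x = s.rreg x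
  rarr : ∀ x, P.writesRArr x = false → s'.rarr x = s.rarr x

theorem Frame.refl (P : Prog) (s : State) : Frame P s s :=
  ⟨fun _ _ => rfl, fun _ _ => rfl, fun _ _ => rfl, fun _ _ => rfl⟩

theorem Frame.trans {P : Prog} {s s' s'' : State} (h : Frame P s s') (h' : Frame P s' s'') :
    Frame P s s'' :=
  ⟨fun x hx => (h'.nreg x hx).trans (h.nreg x hx), fun x hx => (h'.narr x hx).trans (h.narr x hx),
    fun x hx => (h'.rreg x hx).trans (h.rreg x hx), fun x hx => (h'.rarr x hx).trans (h.rarr x hx)⟩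

theorem Frame.mono {P Q : Prog} {s s' : State} (h : Frame P s s')
    (h₁ : ∀ x, Q.writesNReg x = false → P.writesNReg x = false)
    (h₂ : ∀ x, Q.writesNArr x = false → P.writesNArr x = false)
    (h₃ : ∀ x, Q.writesRReg x = false → P.writesRReg x = false)
    (h₄ : ∀ x, Q.writesRArr x = false → P.writesRArr x = false) : Frame Q s s' :=
  ⟨fun x hx => h.nreg x (h₁ x hx), fun x hx => h.narr x (h₂ x hx),
    fun x hx => h.rreg x (h₃ x hx), fun x hx => h.rarr x (h₄ x hx)⟩

/-- The write sets are computed from the syntax. For a concrete program the side conditions of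
`Frame` therefore hold by `rfl`, and specifications need only mention memory that changes. -/
theorem Exec.frame {d : ℕ → ℕ → ℝ} {P : Prog} {s s' : State} {t : ℕ} (h : Exec d P s t s') :
    Frame P s s' := by
  induction h with
  | skip s => exact Frame.refl _ _
  | nset s x e =>
    refine ⟨fun y hy => ?_, fun _ _ => rfl, fun _ _ => rfl, fun _ _ => rfl⟩
    simp only [Prog.writesNReg, beq_eq_false_iff_ne] at hy
    simp [Function.update_of_ne hy]
  | nstore s x e =>
    refine ⟨fun _ _ => rfl, fun y hy => ?_, fun _ _ => rfl, fun _ _ => rfl⟩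
    simp only [Prog.writesNArr, beq_eq_false_iff_ne] at hy
    simp [Function.update_of_ne hy]
  | rset s x e =>
    refine ⟨fun _ _ => rfl, fun _ _ => rfl, fun y hy => ?_, fun _ _ => rfl⟩
    simp only [Prog.writesRReg, beq_eq_false_iff_ne] at hy
    simp [Function.update_of_ne hy]
  | rstore s x e =>
    refine ⟨fun _ _ => rfl, fun _ _ => rfl, fun _ _ => rfl, fun y hy => ?_⟩
    simp only [Prog.writesRArr, beq_eq_false_iff_ne] at hy
    simp [Function.update_of_ne hy]
  | seq _ _ ih ih' =>
    exact (ih.mono (by simp +contextual [Prog.writesNReg]) (by simp +contextual [Prog.writesNArr])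
      (by simp +contextual [Prog.writesRReg]) (by simp +contextual [Prog.writesRArr])).trans
      (ih'.mono (by simp +contextual [Prog.writesNReg]) (by simp +contextual [Prog.writesNArr])
      (by simp +contextual [Prog.writesRReg]) (by simp +contextual [Prog.writesRArr]))
  | ite_true _ _ ih =>
    exact ih.mono (by simp +contextual [Prog.writesNReg]) (by simp +contextual [Prog.writesNArr])
      (by simp +contextual [Prog.writesRReg]) (by simp +contextual [Prog.writesRArr])
  | ite_false _ _ ih =>
    exact ih.mono (by simp +contextual [Prog.writesNReg]) (by simp +contextual [Prog.writesNArr])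
      (by simp +contextual [Prog.writesRReg]) (by simp +contextual [Prog.writesRArr])
  | loop_true _ _ _ ih ih' =>
    refine Frame.trans (ih.mono ?_ ?_ ?_ ?_) ih' <;> exact fun _ h => h
  | loop_false _ => exact Frame.refl _ _

/-! ### Rules for composing programs -/

section

variable {d : ℕ → ℕ → ℝ} {P Q : Prog} {s : State} {T T' : ℕ} {R R' : State → Prop}

theorem Run.mono (h : Run d P s T R) (hT : T ≤ T') (hR : ∀ s', Frame P s s' → R s' → R' s') :
    Run d P s T' R' := by
  obtain ⟨t, s', h, ht, hs⟩ := h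
  exact ⟨t, s', h, ht.trans hT, hR s' h.frame hs⟩

theorem Run.seq (h : Run d P s T R)
    (h' : ∀ s', Frame P s s' → R s' → Run d Q s' T' R') :
    Run d (P.seq Q) s (T + T') R' := by
  obtain ⟨t, s', h, ht, hs⟩ := h
  obtain ⟨t', s'', h'', ht', hs'⟩ := h' s' h.frame hs
  exact ⟨_, s'', h.seq h'', by omega, hs'⟩

theorem Run.ite {b : BExp} (h : b.eval d s → Run d P s T R)
    (h' : ¬ b.eval d s → Run d Q s T R) : Run d (.ite b P Q) s (b.cost + T) R := by
  by_cases hb : b.eval d s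
  · obtain ⟨t, s', h, ht, hs⟩ := h hb
    exact ⟨_, s', .ite_true hb h, by omega, hs⟩
  · obtain ⟨t, s', h, ht, hs⟩ := h' hb
    exact ⟨_, s', .ite_false hb h, by omega, hs⟩

/-- Total correctness of a loop with invariant `R` and variant `v`. -/
theorem Run.loop {b : BExp} (R : State → Prop) (v : State → ℕ) (h₀ : R s)
    (step : ∀ s', Frame P s s' → R s' → b.eval d s' →
      Run d P s' T fun s'' => R s'' ∧ v s'' < v s') :
    Run d (.loop b P) s (v s * (b.cost + T) + b.cost) fun s' => R s' ∧ ¬ b.eval d s' := by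
  have key : ∀ N s', v s' ≤ N → Frame P s s' → R s' →
      Run d (.loop b P) s' (N * (b.cost + T) + b.cost) fun s' => R s' ∧ ¬ b.eval d s' := by
    intro N
    induction N with
    | zero =>
      intro s' hv hf hR
      have hb : ¬ b.eval d s' := by
        intro hb
        obtain ⟨t, s'', -, -, -, hlt⟩ := step s' hf hR hb
        omega
      exact ⟨_, _, .loop_false hb, by omega, hR, hb⟩
    | succ N ih =>
      intro s' hv hf hR
      by_cases hb : b.eval d s'
      · obtain ⟨t, s'', h, ht, hR', hlt⟩ := step s' hf hR hb
        obtain ⟨t', s₃, h', ht', hR₃⟩ := ih s'' (by omega) (hf.trans h.frame) hR'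
        refine ⟨_, s₃, .loop_true hb h h', ?_, hR₃⟩
        rw [Nat.succ_mul]
        omega
      · exact ⟨_, _, .loop_false hb, by omega, hR, hb⟩
  exact key _ s le_rfl (Frame.refl _ _) h₀

end

/-- Programs without loops. -/
def Prog.loopFree : Prog → Bool
  | seq P Q => P.loopFree && Q.loopFree
  | ite _ P Q => P.loopFree && Q.loopFree
  | loop _ _ => false
  | _ => true

/-- A bound for the running time of a program without loops. -/
def Prog.time : Prog → ℕ
  | skip => 1
  | nset _ e => e.cost + 1
  | nstore _ i e => i.cost + e.cost + 1
  | rset _ e => e.cost + 1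
  | rstore _ i e => i.cost + e.cost + 1
  | seq P Q => P.time + Q.time
  | ite b P Q => b.cost + (P.time + Q.time)
  | loop _ _ => 0

open Classical in
/-- The state after running a program without loops. -/
noncomputable def Prog.final (d : ℕ → ℕ → ℝ) : Prog → State → State
  | skip, s => s
  | nset x e, s => { s with nreg := Function.update s.nreg x (e.eval s) }
  | nstore a i e, s =>
      { s with narr := Function.update s.narr a (Function.update (s.narr a) (i.eval s) (e.eval s)) }
  | rset x e, s => { s with rreg := Function.update s.rreg x (e.eval d s) }
  | rstore a i e, s =>
      { s with
        rarr := Function.update s.rarr a (Function.update (s.rarr a) (i.eval s) (e.eval d s)) }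
  | seq P Q, s => Q.final d (P.final d s)
  | ite b P Q, s => if b.eval d s then P.final d s else Q.final d s
  | loop _ _, s => s

theorem Prog.exists_exec_final (d : ℕ → ℕ → ℝ) (P : Prog) (h : P.loopFree = true) (s : State) :
    ∃ t ≤ P.time, Exec d P s t (P.final d s) := by
  induction P generalizing s with
  | skip => exact ⟨_, le_rfl, .skip s⟩
  | nset x e => exact ⟨_, le_rfl, .nset s x e⟩
  | nstore a i e => exact ⟨_, le_rfl, .nstore s a i e⟩
  | rset x e => exact ⟨_, le_rfl, .rset s x e⟩
  | rstore a i e => exact ⟨_, le_rfl, .rstore s a i e⟩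
  | seq P Q ihP ihQ =>
    simp only [loopFree, Bool.and_eq_true] at h
    obtain ⟨t, ht, hP⟩ := ihP h.1 s
    obtain ⟨t', ht', hQ⟩ := ihQ h.2 (P.final d s)
    exact ⟨_, by simp only [time]; omega, hP.seq hQ⟩
  | ite b P Q ihP ihQ =>
    simp only [loopFree, Bool.and_eq_true] at h
    by_cases hb : b.eval d s
    · obtain ⟨t, ht, hP⟩ := ihP h.1 s
      refine ⟨_, ?_, by rw [final, if_pos hb]; exact .ite_true hb hP⟩
      simp only [time]; omega
    · obtain ⟨t, ht, hQ⟩ := ihQ h.2 s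
      refine ⟨_, ?_, by rw [final, if_neg hb]; exact .ite_false hb hQ⟩
      simp only [time]; omega
  | loop b P => simp [loopFree] at h

/-- Reduces a claim about a loop-free program to an explicit computation with function updates. -/
theorem Run.straight {d : ℕ → ℕ → ℝ} {P : Prog} {s : State} {T : ℕ} {R : State → Prop}
    (h : P.loopFree = true) (hT : P.time ≤ T) (hR : R (P.final d s)) : Run d P s T R := by
  obtain ⟨t, ht, he⟩ := P.exists_exec_final d h s
  exact ⟨t, _, he, ht.trans hT, hR⟩

/-- `for x = 0, …, N - 1 do P`. -/
def Prog.forTo (x : ℕ) (N : NExp) (P : Prog) : Prog :=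
  seq (nset x (.const 0))
    (loop (.not (.nle N (.reg x))) (seq P (nset x (.add (.reg x) (.const 1)))))

/-- A round costs `N.cost + 3` for the test and `4` for the increment besides the body. The bound
`N` is re-evaluated each time, hence the hypothesis that its value stays `B`. -/
theorem Run.forTo {d : ℕ → ℕ → ℝ} {x : ℕ} {N : NExp} {P : Prog} {s : State} (B : ℕ)
    (R : ℕ → State → Prop) (hP : P.loopFree = true) (hx : P.writesNReg x = false)
    (hN : ∀ s', Frame (.forTo x N P) s s' → N.eval s' = B)
    (h₀ : ∀ s', Frame (.nset x (.const 0)) s s' → R 0 s')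
    (step : ∀ i s', Frame (.forTo x N P) s s' → i < B → s'.nreg x = i → R i s' →
      R (i + 1) ((Prog.seq P (.nset x (.add (.reg x) (.const 1)))).final d s')) :
    Run d (.forTo x N P) s (B * (N.cost + P.time + 7) + (N.cost + 5)) (R B) := by
  refine (Run.seq (T := 2) (R := fun s' => s'.nreg x = 0 ∧ R 0 s')
    (T' := B * (N.cost + P.time + 7) + (N.cost + 3)) (R' := R B) ?_ ?_).mono
    (by omega) (fun _ _ h => h)
  · obtain ⟨t, ht, he⟩ := (Prog.nset x (.const 0)).exists_exec_final d rfl s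
    exact ⟨t, _, he, ht, by simp [Prog.final, NExp.eval], h₀ _ he.frame⟩
  · rintro s₁ hf₁ ⟨hx₁, hR₁⟩
    have fr₁ : Frame (.forTo x N P) s s₁ :=
      hf₁.mono (by simp +contextual [Prog.forTo, Prog.writesNReg])
        (by simp [Prog.writesNArr]) (by simp [Prog.writesRReg]) (by simp [Prog.writesRArr])
    have fr : ∀ s', Frame (P.seq (.nset x (.add (.reg x) (.const 1)))) s₁ s' →
        Frame (.forTo x N P) s s' := fun s' h =>
      fr₁.trans (h.mono (by simp +contextual [Prog.forTo, Prog.writesNReg])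
        (by simp +contextual [Prog.forTo, Prog.writesNArr])
        (by simp +contextual [Prog.forTo, Prog.writesRReg])
        (by simp +contextual [Prog.forTo, Prog.writesRArr]))
    refine (Run.loop (T := P.time + 4) (v := fun s' => B - s'.nreg x)
      (R := fun s' => s'.nreg x ≤ B ∧ R (s'.nreg x) s') ⟨by omega, by rwa [hx₁]⟩ ?_).mono ?_ ?_
    · rintro s' hf ⟨hle, hR⟩ hb
      simp only [BExp.eval, NExp.eval, hN s' (fr s' hf), not_le] at hb
      refine Run.straight (by simp [Prog.loopFree, hP]) (by simp [Prog.time, NExp.cost]) ?_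
      have key := step _ s' (fr s' hf) hb rfl hR
      obtain ⟨t, -, he⟩ := P.exists_exec_final d hP s'
      have hx' := he.frame.nreg x hx
      have : ((P.seq (.nset x (.add (.reg x) (.const 1)))).final d s').nreg x = s'.nreg x + 1 := by
        simp [Prog.final, NExp.eval, hx']
      rw [this]
      exact ⟨⟨by omega, key⟩, by omega⟩
    · simp only [hx₁, BExp.cost, NExp.cost, Nat.sub_zero]
      apply Nat.add_le_add (Nat.mul_le_mul_left _ _) <;> omega
    · rintro s' hf ⟨⟨hle, hR⟩, hb⟩
      have hf' : Frame (P.seq (.nset x (.add (.reg x) (.const 1)))) s₁ s' :=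
        hf.mono (fun _ h => h) (fun _ h => h) (fun _ h => h) (fun _ h => h)
      simp only [BExp.eval, NExp.eval, hN s' (fr s' hf'), not_not] at hb
      rwa [show s'.nreg x = B by omega] at hR

/-! ### The parts of the program

Natural number registers: `0, 1, 2` hold `n, m, k`; `3` is the number `j` of pivots that have been
matched, `4` the next pivot, `5` the product `j * m`, `6` a flag that stops the main loop.
Natural number arrays: `0, 1, 2` are classes, quotas and output. Candidate edges between pivots and
classes are numbered, an edge `e` joins the pivot `4[e]` to the class `5[e]` by means of the point
`3[e] - 1`, at distance `1[e]` (real array); there is no such edge if `3[e] = 0`. The class of the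
point `10[l]` assigned to pivot `l` is `6[l]`, and `9[i]` pivots are assigned to class `i`. During a
search, `7[i]` is the time at which class `i` was reached, or zero, and `8[i]` the edge by which it
was reached. The output has length register `17`; `11` marks its points, and `12[i]` of them are in
class `i`. Real register `0` is the distance from the next pivot to the previous ones, and real array
`0` holds the distances from all points to the pivots. -/

open Prog in
/-- Insert the edges between the next pivot and the classes. -/
def rowBody : Prog :=
  seq (nset 8 (.add (.reg 5) (.arr 0 (.reg 7)))) <|
  seq (rset 1 (.dist (.reg 4) (.reg 7))) <|
  ite (.not (.and (.nle (.const 1) (.arr 3 (.reg 8))) (.rle (.arr 1 (.reg 8)) (.reg 1))))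
    (seq (nstore 3 (.reg 8) (.add (.reg 7) (.const 1))) <|
     seq (nstore 4 (.reg 8) (.reg 3)) <|
     seq (nstore 5 (.reg 8) (.arr 0 (.reg 7))) <|
     rstore 1 (.reg 8) (.reg 1))
    skip

def rowProg : Prog := .forTo 7 (.reg 0) rowBody

/-- Only the nearest point of each class is kept, in the cell `base + class`, so a pivot contributes
at most `m` edges instead of `n`. Cells from the base on must be empty at the start, since a zero in
array `3` stands for "no edge yet". -/
theorem rowProg_spec (d : ℕ → ℕ → ℝ) (s : State) (hW : ∀ e, s.nreg 5 ≤ e → s.narr 3 e = 0) :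
    Run d rowProg s (60 * s.nreg 0 + 60) fun s' =>
      (∀ e, s.nreg 5 ≤ e → 1 ≤ s'.narr 3 e → ∃ w < s.nreg 0, s'.narr 3 e = w + 1 ∧
        e = s.nreg 5 + s.narr 0 w ∧ s'.narr 4 e = s.nreg 3 ∧ s'.narr 5 e = s.narr 0 w ∧
        s'.rarr 1 e = d (s.nreg 4) w) ∧
      (∀ u < s.nreg 0, 1 ≤ s'.narr 3 (s.nreg 5 + s.narr 0 u) ∧
        s'.rarr 1 (s.nreg 5 + s.narr 0 u) ≤ d (s.nreg 4) u) ∧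
      (∀ e < s.nreg 5, s'.narr 3 e = s.narr 3 e ∧ s'.narr 4 e = s.narr 4 e ∧
        s'.narr 5 e = s.narr 5 e ∧ s'.rarr 1 e = s.rarr 1 e) := by
  refine (Run.forTo (N := .reg 0) (s.nreg 0) (fun i s' =>
      (∀ e, s.nreg 5 ≤ e → 1 ≤ s'.narr 3 e → ∃ w < i, s'.narr 3 e = w + 1 ∧
        e = s.nreg 5 + s.narr 0 w ∧ s'.narr 4 e = s.nreg 3 ∧ s'.narr 5 e = s.narr 0 w ∧
        s'.rarr 1 e = d (s.nreg 4) w) ∧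
      (∀ u < i, 1 ≤ s'.narr 3 (s.nreg 5 + s.narr 0 u) ∧
        s'.rarr 1 (s.nreg 5 + s.narr 0 u) ≤ d (s.nreg 4) u) ∧
      (∀ e < s.nreg 5, s'.narr 3 e = s.narr 3 e ∧ s'.narr 4 e = s.narr 4 e ∧
        s'.narr 5 e = s.narr 5 e ∧ s'.rarr 1 e = s.rarr 1 e)) rfl rfl
      (fun s' hf => hf.nreg 0 rfl) ?_ ?_).mono ?_ fun _ _ h => h
  · intro s' hf
    rw [hf.narr 3 rfl, hf.narr 4 rfl, hf.narr 5 rfl, hf.rarr 1 rfl]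
    exact ⟨fun e he h => by simp [hW e he] at h, by simp, by simp⟩
  · rintro i s' hf hi hx ⟨hs, hc, hu⟩
    have h3 := hf.nreg 3 rfl
    have h4 := hf.nreg 4 rfl
    have h5 := hf.nreg 5 rfl
    have hc0 := hf.narr 0 rfl
    set s₂ := (rowBody.seq (.nset 7 (.add (.reg 7) (.const 1)))).final d s' with hs₂
    by_cases ht : 1 ≤ s'.narr 3 (s.nreg 5 + s.narr 0 i) ∧
      s'.rarr 1 (s.nreg 5 + s.narr 0 i) ≤ d (s.nreg 4) i
    · have e : s₂.narr = s'.narr ∧ s₂.rarr = s'.rarr := by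
        simp [hs₂, Prog.final, rowBody, NExp.eval, BExp.eval, RExp.eval, h4, h5, hc0, hx, ht]
      simp only [e]
      grind
    · have e : s₂.narr 3 = Function.update (s'.narr 3) (s.nreg 5 + s.narr 0 i) (i + 1) ∧
          s₂.narr 4 = Function.update (s'.narr 4) (s.nreg 5 + s.narr 0 i) (s.nreg 3) ∧
          s₂.narr 5 = Function.update (s'.narr 5) (s.nreg 5 + s.narr 0 i) (s.narr 0 i) ∧
          s₂.rarr 1 = Function.update (s'.rarr 1) (s.nreg 5 + s.narr 0 i) (d (s.nreg 4) i) := by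
        simp [hs₂, Prog.final, rowBody, NExp.eval, BExp.eval, RExp.eval, h3, h4, h5, hc0, hx, ht]
      simp only [e, Function.update_apply]
      grind
  · simp [rowBody, Prog.time, BExp.cost, NExp.cost, RExp.cost]
    omega

/-- Forget the classes reached by the previous search. -/
def clearProg : Prog := .forTo 7 (.reg 1) (.nstore 7 (.reg 7) (.const 0))

theorem clearProg_spec (d : ℕ → ℕ → ℝ) (s : State) :
    Run d clearProg s (20 * s.nreg 1 + 20) fun s' => ∀ i < s.nreg 1, s'.narr 7 i = 0 := by
  refine (Run.forTo (N := .reg 1) (s.nreg 1) (fun i s' => ∀ c < i, s'.narr 7 c = 0) rfl rfl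
    (fun s' hf => hf.nreg 1 rfl) (by simp) ?_).mono ?_ fun _ _ h => h
  · intro i s' hf hi hx h
    simp only [Prog.final, NExp.eval, hx, Function.update_self, Function.update_apply]
    grind
  · simp [Prog.time, NExp.cost]
    omega

open Prog in
/-- Find the shortest edge from a reached pivot to a class that is not reached. -/
def scanBody : Prog :=
  ite (.and (.nle (.const 1) (.arr 3 (.reg 8))) <|
       .and (.nle (.const 1) (.arr 7 (.arr 6 (.arr 4 (.reg 8))))) <|
       .and (.nle (.arr 7 (.arr 5 (.reg 8))) (.const 0)) <|
       .not (.and (.nle (.const 1) (.reg 10)) (.rle (.arr 1 (.reg 9)) (.arr 1 (.reg 8)))))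
    (seq (nset 9 (.reg 8)) (nset 10 (.const 1)))
    skip

def scanProg : Prog :=
  .seq (.nset 10 (.const 0)) (.forTo 8 (.add (.reg 5) (.reg 1)) scanBody)

/-- The edge `e` leads from a reached pivot to a class that is not reached. -/
def Leaves (s : State) (e : ℕ) : Prop :=
  1 ≤ s.narr 3 e ∧ 1 ≤ s.narr 7 (s.narr 6 (s.narr 4 e)) ∧ s.narr 7 (s.narr 5 e) = 0

/-- Register `10` records whether a candidate has been found, as there is no infinite length to
start the minimum from. -/
theorem scanProg_spec (d : ℕ → ℕ → ℝ) (s : State)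
    (hex : ∃ e < s.nreg 5 + s.nreg 1, Leaves s e) :
    Run d scanProg s (60 * (s.nreg 5 + s.nreg 1) + 60) fun s' =>
      s'.nreg 9 < s.nreg 5 + s.nreg 1 ∧ Leaves s (s'.nreg 9) ∧
        ∀ e < s.nreg 5 + s.nreg 1, Leaves s e → s.rarr 1 (s'.nreg 9) ≤ s.rarr 1 e := by
  refine (Run.seq (T := 2) (R := fun s' => s'.nreg 10 = 0)
    (Run.straight rfl le_rfl (by simp [Prog.final, NExp.eval])) fun s₁ hf₁ h10 =>
    (Run.forTo (s.nreg 5 + s.nreg 1) (fun i s' =>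
      (s'.nreg 10 = 0 ∧ ∀ e < i, ¬ Leaves s e) ∨
      (s'.nreg 10 = 1 ∧ s'.nreg 9 < i ∧ Leaves s (s'.nreg 9) ∧
        ∀ e < i, Leaves s e → s.rarr 1 (s'.nreg 9) ≤ s.rarr 1 e)) rfl rfl
      ?_ ?_ ?_)).mono ?_ ?_
  · intro s' hf
    simp only [NExp.eval, hf.nreg 5 rfl, hf.nreg 1 rfl, hf₁.nreg 5 rfl, hf₁.nreg 1 rfl]
  · intro s' hf
    left
    simp [hf.nreg 10 rfl, h10]
  · intro i s' hf hi hx hR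
    have h3 := (hf.narr 3 rfl).trans (hf₁.narr 3 rfl)
    have h4 := (hf.narr 4 rfl).trans (hf₁.narr 4 rfl)
    have h5 := (hf.narr 5 rfl).trans (hf₁.narr 5 rfl)
    have h6 := (hf.narr 6 rfl).trans (hf₁.narr 6 rfl)
    have h7 := (hf.narr 7 rfl).trans (hf₁.narr 7 rfl)
    have h1 := (hf.rarr 1 rfl).trans (hf₁.rarr 1 rfl)
    set s₂ := (scanBody.seq (.nset 8 (.add (.reg 8) (.const 1)))).final d s' with hs₂
    by_cases ht : Leaves s i ∧ ¬ (1 ≤ s'.nreg 10 ∧ s.rarr 1 (s'.nreg 9) ≤ s.rarr 1 i)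
    · have e : s₂.nreg 9 = i ∧ s₂.nreg 10 = 1 := by
        rw [Leaves, and_assoc, and_assoc] at ht
        simp only [hs₂, Prog.final, scanBody, NExp.eval, BExp.eval, RExp.eval, hx, h3, h4, h5, h6,
          h7, h1, Nat.le_zero]
        rw [if_pos ht]
        simp
      simp only [e]
      grind
    · have e : s₂.nreg 9 = s'.nreg 9 ∧ s₂.nreg 10 = s'.nreg 10 := by
        have ht' := ht
        rw [Leaves, and_assoc, and_assoc] at ht'
        simp only [hs₂, Prog.final, scanBody, NExp.eval, BExp.eval, RExp.eval, hx, h3, h4, h5, h6,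
          h7, h1, Nat.le_zero]
        rw [if_neg ht']
        simp
      simp only [e]
      grind
  · simp [scanBody, Prog.time, BExp.cost, NExp.cost, RExp.cost]
    omega
  · rintro s' - (⟨-, h⟩ | ⟨-, h⟩)
    · obtain ⟨e, he, hl⟩ := hex
      exact absurd hl (h e he)
    · exact h

open Prog in
/-- Update the distances to the chosen pivots and find a point that is farthest from them. -/
def nextBody : Prog :=
  seq (rset 1 (.dist (.reg 4) (.reg 7))) <|
  seq (ite (.not (.and (.nle (.const 1) (.reg 3)) (.rle (.arr 0 (.reg 7)) (.reg 1))))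
    (rstore 0 (.reg 7) (.reg 1)) skip) <|
  ite (.rle (.reg 0) (.arr 0 (.reg 7))) (seq (rset 0 (.arr 0 (.reg 7))) (nset 14 (.reg 7))) skip

/-- Real constants are not available, so zero is produced as a difference. Distances being
nonnegative, the first point passes the test and sets register `14`. -/
def nextProg : Prog :=
  .seq (.rset 0 (.sub (.reg 0) (.reg 0))) (.forTo 7 (.reg 0) nextBody)

theorem nextProg_spec (d : ℕ → ℕ → ℝ) (s : State) (hd : ∀ u v, 0 ≤ d u v) (hn : 0 < s.nreg 0)
    (hmd : 1 ≤ s.nreg 3 → ∀ u < s.nreg 0, 0 ≤ s.rarr 0 u) :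
    Run d nextProg s (60 * s.nreg 0 + 60) fun s' =>
      (∀ u < s.nreg 0, s'.rarr 0 u = if s.nreg 3 = 0 then d (s.nreg 4) u else
        min (s.rarr 0 u) (d (s.nreg 4) u)) ∧
      (s'.nreg 14 < s.nreg 0 ∧ s'.rreg 0 = s'.rarr 0 (s'.nreg 14)) ∧
      ∀ u < s.nreg 0, s'.rarr 0 u ≤ s'.rreg 0 := by
  refine (Run.seq (T := 4) (R := fun s' => s'.rreg 0 = 0)
    (Run.straight rfl le_rfl (by simp [Prog.final, RExp.eval])) fun s₁ hf₁ h10 =>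
    (Run.forTo (s.nreg 0) (fun i s' =>
      (∀ u < i, s'.rarr 0 u = if s.nreg 3 = 0 then d (s.nreg 4) u else
        min (s.rarr 0 u) (d (s.nreg 4) u)) ∧
      (∀ u, i ≤ u → s'.rarr 0 u = s.rarr 0 u) ∧
      ((i = 0 ∧ s'.rreg 0 = 0) ∨ (s'.nreg 14 < i ∧ s'.rreg 0 = s'.rarr 0 (s'.nreg 14))) ∧
      ∀ u < i, s'.rarr 0 u ≤ s'.rreg 0) rfl rfl
      ?_ ?_ ?_)).mono ?_ ?_
  · intro s' hf
    simp only [NExp.eval, hf.nreg 0 rfl, hf₁.nreg 0 rfl]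
  · intro s' hf
    simp [hf.rreg 0 rfl, h10, hf.rarr 0 rfl, hf₁.rarr 0 rfl]
  · rintro i s' hf hi hx ⟨hm, hu, hr, hl⟩
    have h3 := (hf.nreg 3 rfl).trans (hf₁.nreg 3 rfl)
    have h4 := (hf.nreg 4 rfl).trans (hf₁.nreg 4 rfl)
    set s₂ := (nextBody.seq (.nset 7 (.add (.reg 7) (.const 1)))).final d s' with hs₂
    set x : ℝ := if s.nreg 3 = 0 then d (s.nreg 4) i else min (s.rarr 0 i) (d (s.nreg 4) i)
    -- Needed at `i = 0`, where register `0` is zero and the first point must be accepted as the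
    -- current farthest.
    have hx0 : 0 ≤ x := by
      have := hd (s.nreg 4) i
      simp only [x]
      split_ifs with h
      · exact this
      · exact le_min (hmd (by omega) i hi) this
    have e : s₂.rarr 0 = Function.update (s'.rarr 0) i x ∧
        (s'.rreg 0 ≤ x → s₂.rreg 0 = x ∧ s₂.nreg 14 = i) ∧
        (¬ s'.rreg 0 ≤ x → s₂.rreg 0 = s'.rreg 0 ∧ s₂.nreg 14 = s'.nreg 14) := by
      have hui := hu i le_rfl
      by_cases ht : 1 ≤ s.nreg 3 ∧ s.rarr 0 i ≤ d (s.nreg 4) i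
      · have hxe : x = s.rarr 0 i := by
          simp only [x]
          rw [if_neg (by omega), min_eq_left ht.2]
        rw [hxe]
        by_cases hr : s'.rreg 0 ≤ s.rarr 0 i
        · simp [hs₂, Prog.final, nextBody, NExp.eval, BExp.eval, RExp.eval, h3, h4, hx, ht, hui, hr]
        · simp [hs₂, Prog.final, nextBody, NExp.eval, BExp.eval, RExp.eval, h3, h4, hx, ht, hui, hr]
      · have hxe : x = d (s.nreg 4) i := by
          simp only [x]
          split_ifs with h
          · rfl
          · rw [min_eq_right]
            by_contra h'
            exact ht ⟨by omega, (not_le.1 h').le⟩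
        rw [hxe]
        by_cases hr : s'.rreg 0 ≤ d (s.nreg 4) i
        · simp [hs₂, Prog.final, nextBody, NExp.eval, BExp.eval, RExp.eval, h3, h4, hx, ht, hui, hr]
        · simp [hs₂, Prog.final, nextBody, NExp.eval, BExp.eval, RExp.eval, h3, h4, hx, ht, hui, hr]
    obtain ⟨e, e₁, e₂⟩ := e
    simp only [e, Function.update_apply]
    refine ⟨?_, ?_, ?_, ?_⟩
    · intro u hu'
      split_ifs with h h'
      · subst h; simp [x, h']
      · subst h; simp [x, h']
      · rw [hm u (by omega), if_pos (by assumption)]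
      · rw [hm u (by omega), if_neg (by assumption)]
    · intro u hu'
      rw [if_neg (by omega), hu u (by omega)]
    · grind
    · grind
  · simp [nextBody, Prog.time, BExp.cost, NExp.cost, RExp.cost]
    omega
  · rintro s' - ⟨h, -, h' , h''⟩
    exact ⟨h, h'.resolve_left (by omega), h''⟩

open Prog in
/-- Add the point in register `8` to the output if this respects the quotas. -/
def addProg : Prog :=
  ite (.and (.nle (.arr 11 (.reg 8)) (.const 0))
        (.nle (.add (.arr 12 (.arr 0 (.reg 8))) (.const 1)) (.arr 1 (.arr 0 (.reg 8)))))
    (seq (nstore 2 (.reg 17) (.reg 8)) <|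
     seq (nset 17 (.add (.reg 17) (.const 1))) <|
     seq (nstore 11 (.reg 8) (.const 1)) <|
     nstore 12 (.arr 0 (.reg 8)) (.add (.arr 12 (.arr 0 (.reg 8))) (.const 1)))
    skip

/-- The output and its bookkeeping represent the set `S`. -/
def Holds (s : State) (S : Finset ℕ) : Prop :=
  (∀ u, s.narr 11 u = if u ∈ S then 1 else 0) ∧
  (∀ i, s.narr 12 i = (S.filter fun u => s.narr 0 u = i).card ∧ s.narr 12 i ≤ s.narr 1 i) ∧
  s.nreg 17 = S.card ∧ (Finset.range S.card).image (s.narr 2) = S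

theorem addProg_spec (d : ℕ → ℕ → ℝ) (s : State) (S : Finset ℕ) (h : Holds s S) :
    ((s.nreg 8 ∉ S ∧ s.narr 12 (s.narr 0 (s.nreg 8)) < s.narr 1 (s.narr 0 (s.nreg 8))) ∧
      Holds (addProg.final d s) (insert (s.nreg 8) S)) ∨
    (¬ (s.nreg 8 ∉ S ∧ s.narr 12 (s.narr 0 (s.nreg 8)) < s.narr 1 (s.narr 0 (s.nreg 8))) ∧
      addProg.final d s = s) := by
  obtain ⟨hm, hq, hc, ho⟩ := h
  by_cases ht : s.nreg 8 ∉ S ∧ s.narr 12 (s.narr 0 (s.nreg 8)) < s.narr 1 (s.narr 0 (s.nreg 8))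
  · refine Or.inl ⟨ht, ?_⟩
    have e : addProg.final d s = { s with
        nreg := Function.update s.nreg 17 (S.card + 1)
        narr := Function.update (Function.update (Function.update s.narr
          2 (Function.update (s.narr 2) S.card (s.nreg 8)))
          11 (Function.update (s.narr 11) (s.nreg 8) 1))
          12 (Function.update (s.narr 12) (s.narr 0 (s.nreg 8))
            (s.narr 12 (s.narr 0 (s.nreg 8)) + 1)) } := by
      simp [addProg, Prog.final, BExp.eval, NExp.eval, hm, ht.1, hc, ht.2]
    rw [e]
    refine ⟨?_, ?_, ?_, ?_⟩
    · intro u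
      simp [Function.update_apply, hm]
      grind
    · intro i
      simp only [Finset.filter_insert]
      simp [Function.update_apply]
      by_cases hi : s.narr 0 (s.nreg 8) = i
      · subst hi
        simp [ht.1, hq]
        rw [← (hq _).1]
        exact ht.2
      · simp [hi, Ne.symm hi]
        exact hq i
    · simp [Finset.card_insert_of_notMem ht.1]
    · rw [Finset.card_insert_of_notMem ht.1, Finset.range_add_one, Finset.image_insert]
      have : (Finset.range S.card).image (Function.update (s.narr 2) S.card (s.nreg 8)) = S := by
        refine (Finset.image_congr fun x hx => ?_).trans ho
        exact Function.update_of_ne (Finset.mem_range.1 (Finset.mem_coe.1 hx)).ne _ _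
      simp [this]
  · refine Or.inr ⟨ht, ?_⟩
    have : ¬ (s.narr 11 (s.nreg 8) ≤ 0 ∧
        s.narr 12 (s.narr 0 (s.nreg 8)) + 1 ≤ s.narr 1 (s.narr 0 (s.nreg 8))) := by
      rintro ⟨h1, h2⟩
      refine ht ⟨fun h => ?_, h2⟩
      simp [hm, h] at h1
    exact if_neg this

/-! ### Completing the output -/

theorem Holds.congr {s s' : State} {S : Finset ℕ} (h : Holds s S) (hr : s'.nreg 17 = s.nreg 17)
    (ha : s'.narr = s.narr) : Holds s' S := by
  unfold Holds at *
  rwa [hr, ha]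

def selectProg : Prog := .forTo 7 (.reg 3) (.seq (.nset 8 (.arr 10 (.reg 7))) addProg)

def completeProg : Prog := .forTo 7 (.reg 0) (.seq (.nset 8 (.reg 7)) addProg)

/-- Several pivots may be matched to the same point, so the image can have fewer elements than there
are pivots. `hcap` counts pivots, not points, and so still bounds the class sizes. -/
theorem selectProg_spec (d : ℕ → ℕ → ℝ) (s : State) (h17 : s.nreg 17 = 0)
    (h11 : ∀ u, s.narr 11 u = 0) (h12 : ∀ i, s.narr 12 i = 0)
    (hcap : ∀ i, ((Finset.range (s.nreg 3)).filter
      fun l => s.narr 0 (s.narr 10 l) = i).card ≤ s.narr 1 i) :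
    Run d selectProg s (60 * s.nreg 3 + 60) fun s' =>
      Holds s' ((Finset.range (s.nreg 3)).image (s.narr 10)) := by
  refine (Run.forTo (N := .reg 3) (s.nreg 3)
    (fun i s' => Holds s' ((Finset.range i).image (s.narr 10))) rfl rfl
    (fun s' hf => hf.nreg 3 rfl) ?_ ?_).mono ?_ fun _ _ h => h
  · intro s' hf
    simp [Holds, hf.nreg 17 rfl, hf.narr 11 rfl, hf.narr 12 rfl, h17, h11, h12]
  · intro i s' hf hi hx hH
    have h10 := hf.narr 10 rfl
    have h0 := hf.narr 0 rfl
    have h1 := hf.narr 1 rfl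
    set s₁ := (Prog.nset 8 (.arr 10 (.reg 7))).final d s' with hs₁
    have e8 : s₁.nreg 8 = s.narr 10 i := by simp [hs₁, Prog.final, NExp.eval, hx, h10]
    have ea : s₁.narr = s'.narr := rfl
    have hH₁ : Holds s₁ ((Finset.range i).image (s.narr 10)) :=
      hH.congr (by simp [hs₁, Prog.final]) rfl
    have key : Holds (addProg.final d s₁) ((Finset.range (i + 1)).image (s.narr 10)) := by
      rw [Finset.range_add_one, Finset.image_insert]
      rcases addProg_spec d s₁ _ hH₁ with ⟨-, h⟩ | ⟨hn, h⟩
      · rwa [e8] at h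
      · rw [h]
        -- A rejected point must already be in the output. Otherwise it and the chosen points of its
        -- class are distinct images of pivots matched into that class, of which there are at most
        -- the quota, so the test would have passed.
        have hmem : s.narr 10 i ∈ (Finset.range i).image (s.narr 10) := by
          by_contra hmem
          refine hn ⟨by rwa [e8], ?_⟩
          rw [e8, ea, h0, h1, ← ea, (hH₁.2.1 _).1, ea, h0]
          set c := s.narr 0 (s.narr 10 i)
          refine lt_of_lt_of_le ?_ (hcap c)
          calc _ < (insert (s.narr 10 i) (((Finset.range i).image (s.narr 10)).filter
                  fun u => s.narr 0 u = c)).card := by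
                rw [Finset.card_insert_of_notMem (fun h => hmem (Finset.mem_filter.1 h).1)]
                omega
            _ ≤ (((Finset.range (s.nreg 3)).filter
                  fun l => s.narr 0 (s.narr 10 l) = c).image (s.narr 10)).card := by
                refine Finset.card_le_card fun u hu => ?_
                simp only [Finset.mem_insert, Finset.mem_filter, Finset.mem_image,
                  Finset.mem_range] at hu ⊢
                rcases hu with rfl | ⟨⟨l, hl, rfl⟩, hc⟩
                · exact ⟨i, ⟨hi, rfl⟩, rfl⟩
                · exact ⟨l, ⟨by omega, hc⟩, rfl⟩
            _ ≤ _ := Finset.card_image_le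
        rwa [Finset.insert_eq_of_mem hmem]
    exact key.congr (by simp [Prog.final, hs₁]) rfl
  · simp [addProg, Prog.time, BExp.cost, NExp.cost]
    omega

/-- The result is maximal: a point is left out only if its class is full. A rejection stays
justified because the output only grows. -/
theorem completeProg_spec (d : ℕ → ℕ → ℝ) (s : State) (S₀ : Finset ℕ) (h₀ : Holds s S₀)
    (hS₀ : S₀ ⊆ Finset.range (s.nreg 0)) :
    Run d completeProg s (60 * s.nreg 0 + 60) fun s' => ∃ S, Holds s' S ∧ S₀ ⊆ S ∧
      S ⊆ Finset.range (s.nreg 0) ∧ ∀ u < s.nreg 0, u ∈ S ∨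
        s.narr 1 (s.narr 0 u) ≤ (S.filter fun v => s.narr 0 v = s.narr 0 u).card := by
  refine (Run.forTo (N := .reg 0) (s.nreg 0)
    (fun i s' => ∃ S, Holds s' S ∧ S₀ ⊆ S ∧
      S ⊆ Finset.range (s.nreg 0) ∧ ∀ u < i, u ∈ S ∨
        s.narr 1 (s.narr 0 u) ≤ (S.filter fun v => s.narr 0 v = s.narr 0 u).card) rfl rfl
    (fun s' hf => hf.nreg 0 rfl) ?_ ?_).mono ?_ fun _ _ h => h
  · intro s' hf
    refine ⟨S₀, ?_, subset_rfl, hS₀, by simp⟩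
    unfold Holds at *
    rwa [hf.nreg 17 rfl, hf.narr 11 rfl, hf.narr 12 rfl, hf.narr 0 rfl, hf.narr 1 rfl,
      hf.narr 2 rfl]
  · rintro i s' hf hi hx ⟨S, hH, hS, hSn, hu⟩
    have h0 := hf.narr 0 rfl
    have h1 := hf.narr 1 rfl
    set s₁ := (Prog.nset 8 (.reg 7)).final d s' with hs₁
    have e8 : s₁.nreg 8 = i := by simp [hs₁, Prog.final, NExp.eval, hx]
    have ea : s₁.narr = s'.narr := rfl
    have hH₁ : Holds s₁ S := hH.congr (by simp [hs₁, Prog.final]) rfl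
    have wrap : ∀ S', Holds (addProg.final d s₁) S' →
        Holds ((((Prog.nset 8 (.reg 7)).seq addProg).seq
          (.nset 7 (.add (.reg 7) (.const 1)))).final d s') S' := fun S' h =>
      h.congr (by simp [Prog.final, hs₁]) rfl
    rcases addProg_spec d s₁ _ hH₁ with ⟨-, h⟩ | ⟨hn, h⟩
    · rw [e8] at h
      refine ⟨_, wrap _ h, hS.trans (Finset.subset_insert _ _), ?_, ?_⟩
      · exact Finset.insert_subset (Finset.mem_range.2 hi) hSn
      · intro u hui
        rcases Nat.lt_succ_iff_lt_or_eq.1 hui with hui | rfl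
        · refine (hu u hui).imp (Finset.mem_insert_of_mem) fun h' => h'.trans ?_
          exact Finset.card_le_card (Finset.filter_subset_filter _ (Finset.subset_insert _ _))
        · exact Or.inl (Finset.mem_insert_self _ _)
    · refine ⟨S, wrap _ (by rwa [h]), hS, hSn, fun u hui => ?_⟩
      rcases Nat.lt_succ_iff_lt_or_eq.1 hui with hui | rfl
      · exact hu u hui
      · by_contra hcon
        push Not at hcon
        refine hn ⟨by rw [e8]; exact hcon.1, ?_⟩
        rw [e8, ea, h0, h1, ← ea, (hH₁.2.1 _).1, ea, h0]
        exact hcon.2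
  · simp [addProg, Prog.time, BExp.cost, NExp.cost]
    omega

/-! ### Augmenting the assignment -/

open Prog in
def flipBody : Prog :=
  seq (nset 8 (.arr 8 (.reg 11))) <|
  seq (nset 15 (.arr 4 (.reg 8))) <|
  seq (nstore 10 (.reg 15) (.sub (.arr 3 (.reg 8)) (.const 1))) <|
  seq (nset 16 (.arr 6 (.reg 15))) <|
  seq (nstore 6 (.reg 15) (.reg 11)) <|
  nset 11 (.reg 16)

/-- Reassign pivots along the path found by the search. -/
def flipProg : Prog := .loop (.not (.nle (.reg 1) (.reg 11))) flipBody

/-- The number of pivots `l ≤ j` with `a l = c`. -/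
def load (a : ℕ → ℕ) (j c : ℕ) : ℕ := ((Finset.range (j + 1)).filter fun l => a l = c).card

/-- Written additively, without subtraction, so that the equations of successive reassignments can
be chained. -/
theorem load_update (a : ℕ → ℕ) {j l : ℕ} (hl : l ≤ j) (i c : ℕ) :
    load (Function.update a l i) j c + (if c = a l then 1 else 0) =
      load a j c + if c = i then 1 else 0 := by
  have hmem : l ∈ Finset.range (j + 1) := Finset.mem_range.2 (by omega)
  have key : ∀ b : ℕ → ℕ, load b j c = (if b l = c then 1 else 0) +
      ∑ x ∈ (Finset.range (j + 1)).erase l, if b x = c then 1 else 0 := by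
    intro b
    rw [load, Finset.card_filter, ← Finset.add_sum_erase _ _ hmem]
  have hsum : ∑ x ∈ (Finset.range (j + 1)).erase l, (if Function.update a l i x = c then 1 else 0) =
      ∑ x ∈ (Finset.range (j + 1)).erase l, if a x = c then 1 else 0 := by
    refine Finset.sum_congr rfl fun x hx => ?_
    rw [Function.update_of_ne (Finset.ne_of_mem_erase hx)]
  rw [key, key, hsum, Function.update_self]
  grind

/-- Every reached class has been reached by an edge from a pivot whose class was reached before,
and the edge satisfies `G`. -/
def Tree (G : ℕ → ℕ → Prop) (s : State) : Prop :=
  ∀ i < s.nreg 1, 1 ≤ s.narr 7 i →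
    s.narr 4 (s.narr 8 i) ≤ s.nreg 3 ∧
    1 ≤ s.narr 7 (s.narr 6 (s.narr 4 (s.narr 8 i))) ∧
    s.narr 7 (s.narr 6 (s.narr 4 (s.narr 8 i))) < s.narr 7 i ∧
    s.narr 0 (s.narr 3 (s.narr 8 i) - 1) = i ∧
    G (s.narr 4 (s.narr 8 i)) (s.narr 3 (s.narr 8 i) - 1)

/-- The path is followed backwards from the free class. The total load changes as if one unit were
carried along: it enters at the free class and leaves at the dummy class `m`, whose only member was
the new pivot. The times of reaching decrease strictly, which bounds the number of steps. -/
theorem flipProg_spec (d : ℕ → ℕ → ℝ) (s : State) (G : ℕ → ℕ → Prop) (hT : Tree G s)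
    (ha : ∀ l ≤ s.nreg 3, s.narr 6 l ≤ s.nreg 1 ∧ (s.narr 6 l < s.nreg 1 →
      s.narr 0 (s.narr 10 l) = s.narr 6 l ∧ G l (s.narr 10 l)))
    (hi : s.nreg 11 < s.nreg 1) (hi' : 1 ≤ s.narr 7 (s.nreg 11))
    (hm : load (s.narr 6) (s.nreg 3) (s.nreg 1) = 1) :
    Run d flipProg s (60 * s.narr 7 (s.nreg 11) + 60) fun s' =>
      (∀ l ≤ s.nreg 3, s'.narr 6 l < s.nreg 1 ∧ s.narr 0 (s'.narr 10 l) = s'.narr 6 l ∧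
        G l (s'.narr 10 l)) ∧
      ∀ c < s.nreg 1, load (s'.narr 6) (s.nreg 3) c =
        load (s.narr 6) (s.nreg 3) c + if c = s.nreg 11 then 1 else 0 := by
  refine (Run.loop (P := flipBody) (T := 50) (v := fun s' => s.narr 7 (s'.nreg 11))
    (R := fun s' => s'.nreg 11 ≤ s.nreg 1 ∧ 1 ≤ s.narr 7 (s'.nreg 11) ∧
      -- A pivot may have been reassigned only if its original class was reached no earlier than the
      -- current one.
      (∀ l ≤ s.nreg 3, s'.narr 6 l = s.narr 6 l ∨
        s.narr 7 (s'.nreg 11) ≤ s.narr 7 (s.narr 6 l)) ∧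
      (∀ l ≤ s.nreg 3, s'.narr 6 l ≤ s.nreg 1 ∧ (s'.narr 6 l < s.nreg 1 →
        s.narr 0 (s'.narr 10 l) = s'.narr 6 l ∧ G l (s'.narr 10 l))) ∧
      (∀ c, load (s'.narr 6) (s.nreg 3) c + (if c = s'.nreg 11 then 1 else 0) =
        load (s.narr 6) (s.nreg 3) c + if c = s.nreg 11 then 1 else 0))
      ⟨hi.le, hi', by simp, ha, by simp⟩ ?_).mono ?_ ?_
  · rintro s' hf ⟨hle, h1, hch, hac, hld⟩ hb
    have e1 := hf.nreg 1 rfl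
    have e4 := hf.narr 4 rfl
    have e8 := hf.narr 8 rfl
    have e3 := hf.narr 3 rfl
    simp only [BExp.eval, NExp.eval, e1, not_le] at hb
    refine Run.straight rfl (by decide) ?_
    set s₂ := flipBody.final d s' with hs₂
    set i := s'.nreg 11 with hi
    set e := s.narr 8 i with he
    set l := s.narr 4 e with hl
    obtain ⟨hlj, hq1, hq2, hcol, hG⟩ := hT i hb h1
    -- The edge starts in a class reached strictly before `i`, so its pivot has not been moved yet.
    have hal : s'.narr 6 l = s.narr 6 l := (hch l hlj).resolve_right (by
      simp only [← he, ← hl] at hq2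
      omega)
    have e : s₂.nreg 11 = s.narr 6 l ∧
        s₂.narr 6 = Function.update (s'.narr 6) l i ∧
        s₂.narr 10 = Function.update (s'.narr 10) l (s.narr 3 e - 1) := by
      simp [hs₂, Prog.final, flipBody, NExp.eval, e3, e4, e8, ← hal, ← hi, ← he, ← hl]
    obtain ⟨e11, e6, e10⟩ := e
    rw [e11, e6, e10]
    refine ⟨⟨(ha l hlj).1, hq1, ?_, ?_, ?_⟩, hq2⟩
    · intro x hx
      by_cases hxl : x = l
      · subst hxl
        exact Or.inr le_rfl
      · rw [Function.update_of_ne hxl]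
        refine (hch x hx).imp id fun h => ?_
        simp only [← he, ← hl] at hq2
        omega
    · intro x hx
      by_cases hxl : x = l
      · subst hxl
        simp only [Function.update_self]
        exact ⟨hb.le, fun _ => ⟨hcol, hG⟩⟩
      · simp only [Function.update_of_ne hxl]
        exact hac x hx
    · intro c
      have := load_update (s'.narr 6) hlj i c
      rw [hal] at this
      linarith [hld c]
  · have : BExp.cost (.not (.nle (.reg 1) (.reg 11))) = 4 := rfl
    rw [this]
    omega
  · rintro s' hf ⟨⟨hle, h1, hch, hac, hld⟩, hb⟩
    have e1 := hf.nreg 1 rfl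
    simp only [BExp.eval, NExp.eval, e1, not_not] at hb
    have h11 : s'.nreg 11 = s.nreg 1 := by omega
    -- At the dummy class the unit being carried accounts for its initial load `1`, so nothing
    -- remains there.
    have hzero : load (s'.narr 6) (s.nreg 3) (s.nreg 1) = 0 := by
      have := hld (s.nreg 1)
      rw [h11, hm] at this
      simp [hi.ne'] at this
      exact this
    have hlt : ∀ l ≤ s.nreg 3, s'.narr 6 l < s.nreg 1 := by
      intro l hl
      refine lt_of_le_of_ne (hac l hl).1 fun h => ?_
      rw [load, Finset.card_eq_zero, Finset.filter_eq_empty_iff] at hzero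
      exact hzero (Finset.mem_range.2 (by omega)) h
    refine ⟨fun l hl => ⟨hlt l hl, (hac l hl).2 (hlt l hl)⟩, fun c hc => ?_⟩
    have := hld c
    rwa [h11, if_neg hc.ne, add_zero] at this

/-! ### The search for an augmenting path -/

open Prog in
def reachProg : Prog :=
  seq (nset 11 (.arr 5 (.reg 9))) <|
  seq (nstore 8 (.reg 11) (.reg 9)) <|
  seq (nset 12 (.add (.reg 12) (.const 1))) <|
  seq (nstore 7 (.reg 11) (.reg 12)) <|
  ite (.and (.nle (.const 1) (.reg 3))
        (.not (.rle (.add (.arr 1 (.reg 9)) (.arr 1 (.reg 9))) (.reg 0))))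
    (seq (nset 6 (.const 1)) (nset 13 (.const 1)))
    (ite (.nle (.add (.arr 9 (.reg 11)) (.const 1)) (.arr 1 (.reg 11))) (nset 13 (.const 1)) skip)

/-- Reach classes by edges that are as short as possible, until a class with a free place is
reached. Give up if an edge is longer than half the distance from the next pivot to the others. -/
def searchProg : Prog := .loop (.nle (.reg 13) (.const 0)) (.seq scanProg reachProg)

/-- The edge `e` leads from a pivot of a class in `Q`, or from the next pivot, to a class that is
not in `Q`. -/
def LeavesSet (s : State) (Q : Finset ℕ) (e : ℕ) : Prop :=
  1 ≤ s.narr 3 e ∧ (s.narr 6 (s.narr 4 e) = s.nreg 1 ∨ s.narr 6 (s.narr 4 e) ∈ Q) ∧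
    s.narr 5 e ∉ Q

/-- The set of reached classes. -/
def reached (s : State) : Finset ℕ := (Finset.range (s.nreg 1)).filter fun i => 1 ≤ s.narr 7 i

/-- The search is kept apart from the geometry. `hleave` keeps it from getting stuck while all
reached classes are full, and `hshort` says what the length test means: `Z` when the search gives
up, `G` for each edge it uses. These become `PivotsCover` and `Near`. -/
theorem searchProg_spec (d : ℕ → ℕ → ℝ) (s : State) (G : ℕ → ℕ → Prop) (Z : Prop)
    (h6 : s.nreg 6 = 0) (h13 : s.nreg 13 = 0) (h12 : s.nreg 12 = 1)
    (hQm : s.narr 7 (s.nreg 1) = 1) (hQ : ∀ i < s.nreg 1, s.narr 7 i = 0)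
    (hedge : ∀ e < s.nreg 5 + s.nreg 1, 1 ≤ s.narr 3 e → s.narr 4 e ≤ s.nreg 3 ∧
      s.narr 6 (s.narr 4 e) ≤ s.nreg 1 ∧ s.narr 5 e < s.nreg 1 ∧
      s.narr 0 (s.narr 3 e - 1) = s.narr 5 e)
    (hleave : ∀ Q ⊆ Finset.range (s.nreg 1), (∀ i ∈ Q, s.narr 1 i ≤ s.narr 9 i) →
      ∃ e < s.nreg 5 + s.nreg 1, LeavesSet s Q e)
    (hshort : ∀ Q ⊆ Finset.range (s.nreg 1), (∀ i ∈ Q, s.narr 1 i ≤ s.narr 9 i) →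
      ∀ e < s.nreg 5 + s.nreg 1, LeavesSet s Q e →
      (∀ e' < s.nreg 5 + s.nreg 1, LeavesSet s Q e' → s.rarr 1 e ≤ s.rarr 1 e') →
      if 1 ≤ s.nreg 3 ∧ ¬ s.rarr 1 e + s.rarr 1 e ≤ s.rreg 0 then Z
      else G (s.narr 4 e) (s.narr 3 e - 1)) :
    Run d searchProg s ((s.nreg 1 + 1) * (60 * (s.nreg 5 + s.nreg 1) + 200) + 3) fun s' =>
      (1 ≤ s'.nreg 6 ∧ Z) ∨ (s'.nreg 6 = 0 ∧ s'.nreg 11 < s.nreg 1 ∧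
        1 ≤ s'.narr 7 (s'.nreg 11) ∧ s'.narr 7 (s'.nreg 11) ≤ s.nreg 1 + 1 ∧
        s.narr 9 (s'.nreg 11) < s.narr 1 (s'.nreg 11) ∧ Tree G s') := by
  refine (Run.loop (P := .seq scanProg reachProg) (T := 60 * (s.nreg 5 + s.nreg 1) + 190)
    -- Register `12` is one more than the number of reached classes and grows with each class
    -- reached; when a scan begins it is at most `m + 1`.
    (v := fun s' => if s'.nreg 13 = 0 then s.nreg 1 + 2 - s'.nreg 12 else 0)
    (R := fun s' => (1 ≤ s'.nreg 13 ∧ 1 ≤ s'.nreg 6 ∧ Z) ∨ (s'.nreg 6 = 0 ∧ Tree G s' ∧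
      s'.nreg 12 = (reached s').card + 1 ∧ (∀ i ≤ s.nreg 1, s'.narr 7 i ≤ s'.nreg 12) ∧
      s'.narr 7 (s.nreg 1) = 1 ∧
      ((s'.nreg 13 = 0 ∧ ∀ i ∈ reached s', s.narr 1 i ≤ s.narr 9 i) ∨
       (s'.nreg 13 = 1 ∧ s'.nreg 11 < s.nreg 1 ∧ 1 ≤ s'.narr 7 (s'.nreg 11) ∧
        s.narr 9 (s'.nreg 11) < s.narr 1 (s'.nreg 11))))) ?_ ?_).mono ?_ ?_
  · have hr : reached s = ∅ := by
      rw [reached, Finset.filter_eq_empty_iff]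
      intro i hi
      simp [hQ i (Finset.mem_range.1 hi)]
    refine Or.inr ⟨h6, ?_, by simp [hr, h12], ?_, hQm, Or.inl ⟨h13, by simp [hr]⟩⟩
    · intro i hi h
      simp [hQ i hi] at h
    · intro i hi
      rcases hi.lt_or_eq with h | rfl
      · simp [hQ i h]
      · simp [hQm, h12]
  · rintro s' hf hR hb
    simp only [BExp.eval, NExp.eval, Nat.le_zero] at hb
    rcases hR with ⟨h, -⟩ | ⟨h6', hT, hcard, hle, hm1, hR⟩
    · omega
    have hsat : ∀ i ∈ reached s', s.narr 1 i ≤ s.narr 9 i := by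
      rcases hR with h | h
      · exact h.2
      · omega
    have g1 := hf.nreg 1 rfl
    have g3 := hf.nreg 3 rfl
    have g5 := hf.nreg 5 rfl
    have a0 := hf.narr 0 rfl
    have a1 := hf.narr 1 rfl
    have a3 := hf.narr 3 rfl
    have a4 := hf.narr 4 rfl
    have a5 := hf.narr 5 rfl
    have a6 := hf.narr 6 rfl
    have a9 := hf.narr 9 rfl
    have r1 := hf.rarr 1 rfl
    have rr := hf.rreg 0 rfl
    have hQs : reached s' ⊆ Finset.range (s.nreg 1) := by
      rw [← g1]
      exact Finset.filter_subset _ _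
    have hmemQ : ∀ c, c ∈ reached s' ↔ c < s.nreg 1 ∧ 1 ≤ s'.narr 7 c := by
      intro c
      rw [reached, Finset.mem_filter, Finset.mem_range, g1]
    -- The dummy class is not an element of `reached`, but its time `1` makes it count as reached in
    -- `Leaves`.
    have hLeq : ∀ e < s.nreg 5 + s.nreg 1, Leaves s' e ↔ LeavesSet s (reached s') e := by
      intro e he
      simp only [Leaves, LeavesSet, a3, a4, a5, a6, hmemQ]
      refine and_congr_right fun hw => ?_
      obtain ⟨-, h2, h3, -⟩ := hedge e he hw
      refine and_congr ?_ (by omega)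
      rcases h2.lt_or_eq with h | h
      · simp [h, h.ne]
      · simp [h, hm1]
    have ht : s'.nreg 12 ≤ s.nreg 1 + 1 := by
      have := Finset.card_le_card hQs
      rw [Finset.card_range] at this
      omega
    refine (Run.seq (T' := 100) (scanProg_spec d s' ?_) ?_).mono ?_ fun _ _ h => h
    · obtain ⟨e, he, h⟩ := hleave _ hQs hsat
      exact ⟨e, by rwa [g5, g1], (hLeq e he).2 h⟩
    · rintro s₁ hf₁ ⟨he, hL, hmin⟩
      rw [g5, g1] at he hmin
      set e := s₁.nreg 9 with hee
      have hkey := hshort _ hQs hsat e he ((hLeq e he).1 hL) (by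
        intro e' he' h
        rw [← r1]
        exact hmin e' he' ((hLeq e' he').2 h))
      obtain ⟨hw, hL2, hL3⟩ := hL
      obtain ⟨q1, q2, q3, q4⟩ := hedge e he (by rwa [← a3])
      set i := s.narr 5 e with hi
      have hi0 : s'.narr 7 i = 0 := by rwa [a5] at hL3
      refine Run.straight rfl (by decide) ?_
      set s₂ := reachProg.final d s₁ with hs₂
      have b1 := (hf₁.nreg 1 rfl).trans g1
      have b3 := (hf₁.nreg 3 rfl).trans g3
      have b6 := (hf₁.nreg 6 rfl).trans h6'
      have b12 := hf₁.nreg 12 rfl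
      have b13 := (hf₁.nreg 13 rfl).trans hb
      have c0 := (hf₁.narr 0 rfl).trans a0
      have c1 := (hf₁.narr 1 rfl).trans a1
      have c3 := (hf₁.narr 3 rfl).trans a3
      have c4 := (hf₁.narr 4 rfl).trans a4
      have c5 := (hf₁.narr 5 rfl).trans a5
      have c6 := (hf₁.narr 6 rfl).trans a6
      have c7 := hf₁.narr 7 rfl
      have c8 := hf₁.narr 8 rfl
      have c9 := (hf₁.narr 9 rfl).trans a9
      have d1 := (hf₁.rarr 1 rfl).trans r1
      have d0 := (hf₁.rreg 0 rfl).trans rr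
      by_cases hhalt : 1 ≤ s.nreg 3 ∧ ¬ s.rarr 1 e + s.rarr 1 e ≤ s.rreg 0
      · rw [if_pos hhalt] at hkey
        have hz : s₂.nreg 13 = 1 ∧ s₂.nreg 6 = 1 := by
          simp [hs₂, reachProg, Prog.final, NExp.eval, BExp.eval, RExp.eval, b3, d1, d0, ← hee,
            hhalt.1, not_le.1 hhalt.2]
        refine ⟨Or.inl ⟨by omega, by omega, hkey⟩, ?_⟩
        simp only [hz, hb]
        simp
        omega
      · rw [if_neg hhalt] at hkey
        have hz : s₂.nreg 1 = s.nreg 1 ∧ s₂.nreg 3 = s.nreg 3 ∧ s₂.nreg 6 = 0 ∧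
            s₂.nreg 11 = i ∧ s₂.nreg 12 = s'.nreg 12 + 1 ∧
            s₂.narr 7 = Function.update (s'.narr 7) i (s'.nreg 12 + 1) ∧
            s₂.narr 8 = Function.update (s'.narr 8) i e ∧
            s₂.narr 0 = s.narr 0 ∧ s₂.narr 3 = s.narr 3 ∧ s₂.narr 4 = s.narr 4 ∧
            s₂.narr 6 = s.narr 6 ∧
            s₂.nreg 13 = if s.narr 9 i + 1 ≤ s.narr 1 i then 1 else 0 := by
          rw [not_le] at hhalt
          by_cases hc : s.narr 9 i + 1 ≤ s.narr 1 i <;>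
          simp [hs₂, reachProg, Prog.final, NExp.eval, BExp.eval, RExp.eval, b1, b3, b6, b12, b13,
            c0, c1, c3, c4, c5, c6, c7, c8, c9, d1, d0, hc, hhalt, ← hee, ← hi]
        obtain ⟨z1, z3, z6, z11, z12, y7, y8, y0, y3, y4, y6, z13⟩ := hz
        have hreach : reached s₂ = insert i (reached s') := by
          ext c
          simp only [reached, Finset.mem_insert, Finset.mem_filter, Finset.mem_range, z1, y7, g1,
            Function.update_apply]
          grind
        have hinot : i ∉ reached s' := by
          rw [hmemQ, hi0]
          omega
        have hT₂ : Tree G s₂ := by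
          -- The new class had time zero, so stamping it alters no earlier time and the old part of
          -- the tree survives.
          have hold : ∀ c, 1 ≤ s'.narr 7 c →
              Function.update (s'.narr 7) i (s'.nreg 12 + 1) c = s'.narr 7 c := by
            intro c hc
            refine Function.update_of_ne ?_ _ _
            rintro rfl
            omega
          intro c hc hc1
          rw [z1] at hc
          rw [y7] at hc1
          rw [y7, y8, y0, y3, y4, y6, z3]
          by_cases hci : c = i
          · subst hci
            rw [a6, a4] at hL2
            simp only [Function.update_self]
            rw [hold _ hL2]
            exact ⟨q1, hL2, Nat.lt_succ_of_le (hle _ q2), q4, hkey⟩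
          · simp only [Function.update_of_ne hci] at hc1 ⊢
            have := hT c (by rwa [g1]) hc1
            rw [a0, a3, a4, a6, g3] at this
            rwa [hold _ this.2.1]
        refine ⟨Or.inr ⟨z6, hT₂, ?_, ?_, ?_, ?_⟩, ?_⟩
        · rw [z12, hreach, Finset.card_insert_of_notMem hinot, hcard]
        · intro c hc
          rw [y7, z12, Function.update_apply]
          split_ifs
          · exact le_rfl
          · exact (hle c hc).trans (by omega)
        · rw [y7, Function.update_of_ne q3.ne', hm1]
        · rw [z13, z11, hreach, y7, Function.update_self]
          split_ifs with hc
          · exact Or.inr ⟨rfl, q3, by omega, hc⟩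
          · refine Or.inl ⟨rfl, fun c hcm => ?_⟩
            rcases Finset.mem_insert.1 hcm with rfl | h
            · omega
            · exact hsat c h
        · rw [z13, z12, hb]
          split_ifs <;> omega
    · rw [g5, g1]
      omega
  · rw [h13, h12, show BExp.cost (.nle (.reg 13) (.const 0)) = 3 from rfl, if_pos rfl]
    refine Nat.add_le_add_right (Nat.mul_le_mul ?_ ?_) _ <;> omega
  · rintro s' hf ⟨hR, hb⟩
    simp only [BExp.eval, NExp.eval, Nat.le_zero] at hb
    have g1 := hf.nreg 1 rfl
    rcases hR with ⟨-, h⟩ | ⟨h6', hT, hcard, hle, hm1, hR⟩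
    · exact Or.inl h
    · obtain ⟨h, -⟩ | ⟨-, h11, h7, h9⟩ := hR
      · exact absurd h hb
      · refine Or.inr ⟨h6', h11, h7, (hle _ h11.le).trans ?_, h9, hT⟩
        have : (reached s').card ≤ s.nreg 1 := by
          rw [← g1]
          exact (Finset.card_filter_le _ _).trans (Finset.card_range _).le
        omega

/-! ### Separated pivots and covers -/

namespace Problem

variable (I : Problem)

/-- The class of a point, given by its index. -/
def col : ℕ → ℕ := I.input.narr 0

/-- The quota of a class, given by its index. -/
def quo : ℕ → ℕ := I.input.narr 1

/-- `T` is a fair set of point indices with radius at most `r`. -/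
structure Cover (T : Finset ℕ) (r : ℝ) : Prop where
  subset : T ⊆ Finset.range I.n
  fair : ∀ i < I.m, (T.filter fun u => I.col u = i).card = I.quo i
  cover : ∀ u < I.n, ∃ t ∈ T, I.oracle u t ≤ r

variable {I}

theorem col_val (u : Fin I.n) : I.col u = I.color u := by
  simp [col, input]

theorem quo_val (i : Fin I.m) : I.quo i = I.quota i := by
  simp [quo, input]

theorem col_lt {u : ℕ} (hu : u < I.n) : I.col u < I.m := by
  rw [show u = ((⟨u, hu⟩ : Fin I.n) : ℕ) from rfl, col_val]
  exact (I.color _).2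

theorem sum_quo : ∑ i ∈ Finset.range I.m, I.quo i = I.k := by
  rw [Finset.sum_range, k]
  exact Finset.sum_congr rfl fun i _ => quo_val i

theorem oracle_val (u v : Fin I.n) : I.oracle u v = I.dist u v := by
  simp [oracle]

theorem oracle_nonneg (u v : ℕ) : 0 ≤ I.oracle u v := by
  unfold oracle
  split_ifs
  · exact I.dist_nonneg _ _
  · exact le_rfl

theorem oracle_comm (u v : ℕ) : I.oracle u v = I.oracle v u := by
  unfold oracle
  split_ifs with h h' h'
  · exact I.dist_comm _ _
  · exact absurd h.symm h'
  · exact absurd h'.symm h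
  · rfl

theorem oracle_triangle {u v w : ℕ} (hu : u < I.n) (hv : v < I.n) (hw : w < I.n) :
    I.oracle u v ≤ I.oracle u w + I.oracle w v := by
  simp only [oracle, hu, hv, hw, and_self, dite_true]
  exact I.dist_triangle _ _ _

theorem Cover.card_filter {T : Finset ℕ} {r : ℝ} (h : I.Cover T r) {Q : Finset ℕ}
    (hQ : Q ⊆ Finset.range I.m) :
    (T.filter fun u => I.col u ∈ Q).card = ∑ i ∈ Q, I.quo i := by
  rw [← Finset.sum_card_fiberwise_eq_card_filter]
  exact Finset.sum_congr rfl fun i hi => h.fair i (Finset.mem_range.1 (hQ hi))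

theorem Cover.card_eq {T : Finset ℕ} {r : ℝ} (h : I.Cover T r) : T.card = I.k := by
  rw [← sum_quo, ← h.card_filter subset_rfl, Finset.filter_true_of_mem]
  exact fun u hu => Finset.mem_range.2 (col_lt (Finset.mem_range.1 (h.subset hu)))

/-- Sending each pivot to a center within `r` is injective, since two pivots with a common center
are at distance at most `2 * r`. -/
theorem card_le_of_separated {P : ℕ → ℕ} {R T : Finset ℕ} {r : ℝ} (hP : ∀ l ∈ R, P l < I.n)
    (hT : ∀ t ∈ T, t < I.n)
    (hsep : ∀ l ∈ R, ∀ l' ∈ R, l < l' → 2 * r < I.oracle (P l) (P l'))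
    (hnear : ∀ l ∈ R, ∃ t ∈ T, I.oracle (P l) t ≤ r) : R.card ≤ T.card := by
  choose! f hfT hf using hnear
  refine Finset.card_le_card_of_injOn f (fun l hl => hfT l hl) fun l hl l' hl' heq => ?_
  have key : ∀ l ∈ R, ∀ l' ∈ R, f l = f l' → ¬ l < l' := by
    intro l hl l' hl' heq hlt
    have h₁ := hsep l hl l' hl' hlt
    have h₂ := oracle_triangle (hP l hl) (hP l' hl') (hT _ (hfT l hl))
    have h₃ := hf l hl
    have h₄ := hf l' hl'
    rw [oracle_comm, ← heq] at h₄
    linarith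
  exact le_antisymm (not_lt.1 (key l' hl' l hl heq.symm)) (not_lt.1 (key l hl l' hl' heq))

/-- If the classes in `Q` are full, a pivot assigned to one of them, or the new pivot, is near a
center of another class. -/
theorem Cover.exists_near {T : Finset ℕ} {r : ℝ} (h : I.Cover T r) {P a : ℕ → ℕ} {j : ℕ}
    (hP : ∀ l ≤ j, P l < I.n) (haj : a j = I.m)
    (hsep : ∀ l l', l < l' → l' ≤ j → 2 * r < I.oracle (P l) (P l')) {Q : Finset ℕ}
    (hQ : Q ⊆ Finset.range I.m)
    (hfull : ∀ i ∈ Q, I.quo i ≤ ((Finset.range j).filter fun l => a l = i).card) :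
    ∃ l ≤ j, (a l = I.m ∨ a l ∈ Q) ∧ ∃ u < I.n, I.oracle (P l) u ≤ r ∧ I.col u ∉ Q := by
  by_contra hcon
  push Not at hcon
  -- `R` has more elements than the quotas of `Q` add up to. If all near points had classes in `Q`,
  -- it would inject into the centers of these classes, whose number is exactly that sum.
  set R := insert j ((Finset.range j).filter fun l => a l ∈ Q) with hR
  have hRj : ∀ l ∈ R, l ≤ j ∧ (a l = I.m ∨ a l ∈ Q) := by
    intro l hl
    rcases Finset.mem_insert.1 hl with rfl | hl
    · exact ⟨le_rfl, Or.inl haj⟩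
    · have := Finset.mem_filter.1 hl
      exact ⟨(Finset.mem_range.1 this.1).le, Or.inr this.2⟩
  have hT : ∀ t ∈ T, t < I.n := fun t ht => Finset.mem_range.1 (h.subset ht)
  have hcard : R.card ≤ (T.filter fun u => I.col u ∈ Q).card := by
    refine card_le_of_separated (P := P) (r := r) (fun l hl => hP l (hRj l hl).1)
      (fun t ht => hT t (Finset.mem_filter.1 ht).1)
      (fun l _ l' hl' hlt => hsep l l' hlt (hRj l' hl').1) fun l hl => ?_
    obtain ⟨t, ht, hle⟩ := h.cover (P l) (hP l (hRj l hl).1)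
    exact ⟨t, Finset.mem_filter.2 ⟨ht, hcon l (hRj l hl).1 (hRj l hl).2 t (hT t ht) hle⟩, hle⟩
  rw [h.card_filter hQ, hR, Finset.card_insert_of_notMem (by simp)] at hcard
  have := (Finset.sum_le_sum hfull).trans (Finset.sum_card_fiberwise_eq_card_filter _ Q a).le
  omega

/-- If the classes in `Q` are full but not all pivots are assigned, there is a point of another
class. -/
theorem Cover.exists_not_mem {T : Finset ℕ} {r : ℝ} (h : I.Cover T r) {a : ℕ → ℕ} {j : ℕ}
    (hj : j < I.k) {Q : Finset ℕ} (hQ : Q ⊆ Finset.range I.m)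
    (hfull : ∀ i ∈ Q, I.quo i ≤ ((Finset.range j).filter fun l => a l = i).card) :
    ∃ u < I.n, I.col u ∉ Q := by
  by_contra hcon
  push Not at hcon
  have h₁ := h.card_filter hQ
  rw [Finset.filter_true_of_mem (fun t ht => hcon t (Finset.mem_range.1 (h.subset ht))),
    h.card_eq] at h₁
  have h₂ := (Finset.sum_le_sum hfull).trans (Finset.sum_card_fiberwise_eq_card_filter _ Q a).le
  have h₃ := Finset.card_filter_le (Finset.range j) fun l => a l ∈ Q
  rw [Finset.card_range] at h₃
  omega

/-- With `k + 1` pivots, two of them are near the same center. -/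
theorem Cover.not_separated {T : Finset ℕ} {r : ℝ} (h : I.Cover T r) {P : ℕ → ℕ}
    (hP : ∀ l ≤ I.k, P l < I.n) :
    ¬ ∀ l l', l < l' → l' ≤ I.k → 2 * r < I.oracle (P l) (P l') := by
  intro hsep
  have := card_le_of_separated (I := I) (P := P) (R := Finset.range (I.k + 1)) (T := T) (r := r)
    (fun l hl => hP l (by simpa [Nat.lt_succ_iff] using hl))
    (fun t ht => Finset.mem_range.1 (h.subset ht))
    (fun l _ l' hl' hlt => hsep l l' hlt (by simpa [Nat.lt_succ_iff] using hl'))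
    (fun l hl => h.cover (P l) (hP l (by simpa [Nat.lt_succ_iff] using hl)))
  rw [Finset.card_range, h.card_eq] at this
  omega

end Problem

/-! ### The main loop -/

open Prog in
/-- Start the search: only the dummy class `m` of the next pivot is reached. -/
def startProg : Prog :=
  seq (nstore 6 (.reg 3) (.reg 1)) <|
  seq (nstore 7 (.reg 1) (.const 1)) <|
  seq (nset 12 (.const 1)) <|
  nset 13 (.const 0)

open Prog in
def stepProg : Prog :=
  seq (nset 4 (.reg 14)) <|
  seq (nset 3 (.add (.reg 3) (.const 1))) <|
  nset 5 (.add (.reg 5) (.reg 1))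

open Prog in
def advanceProg : Prog :=
  seq (nstore 9 (.reg 11) (.add (.arr 9 (.reg 11)) (.const 1))) <|
  seq flipProg <| seq nextProg stepProg

open Prog in
def prepareProg : Prog := seq rowProg <| seq clearProg <| seq startProg searchProg

open Prog in
def mainBody : Prog := seq prepareProg (ite (.nle (.reg 6) (.const 0)) advanceProg skip)

def mainLoop : Prog :=
  .loop (.and (.not (.nle (.reg 2) (.reg 3))) (.nle (.reg 6) (.const 0))) mainBody

/-- The pivots `P l` with `l < j` are within distance `2 r` of all points, whenever there is a fair
set of radius `r`. -/
def PivotsCover (I : Problem) (P : ℕ → ℕ) (j : ℕ) : Prop :=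
  ∀ T r, I.Cover T r → ∀ u < I.n, ∃ l < j, I.oracle u (P l) ≤ 2 * r

/-- What the main loop guarantees about the assigned points. -/
structure Core (I : Problem) (P : ℕ → ℕ) (s : State) : Prop where
  n_eq : s.nreg 0 = I.n
  m_eq : s.nreg 1 = I.m
  k_eq : s.nreg 2 = I.k
  col_eq : s.narr 0 = I.col
  quo_eq : s.narr 1 = I.quo
  j_le : s.nreg 3 ≤ I.k
  pivot_lt : ∀ l < s.nreg 3, P l < I.n
  near : ∀ l < s.nreg 3, s.narr 10 l < I.n ∧
    ∀ T r, I.Cover T r → I.oracle (P l) (s.narr 10 l) ≤ r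
  cap : ∀ i, ((Finset.range (s.nreg 3)).filter fun l => I.col (s.narr 10 l) = i).card ≤ I.quo i
  out : s.nreg 17 = 0 ∧ (∀ u, s.narr 11 u = 0) ∧ ∀ i, s.narr 12 i = 0

/-- The invariant of the main loop. -/
structure MainInv (I : Problem) (P : ℕ → ℕ) (s : State) : Prop extends Core I P s where
  base_eq : s.nreg 5 = s.nreg 3 * I.m
  next_eq : P (s.nreg 3) = s.nreg 4
  next_lt : s.nreg 4 < I.n
  mindist : 1 ≤ s.nreg 3 → ∀ u < I.n, (∃ l < s.nreg 3, s.rarr 0 u = I.oracle (P l) u) ∧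
    ∀ l < s.nreg 3, s.rarr 0 u ≤ I.oracle (P l) u
  far : 1 ≤ s.nreg 3 → s.rreg 0 = s.rarr 0 (s.nreg 4) ∧ ∀ u < I.n, s.rarr 0 u ≤ s.rreg 0
  sep : ∀ l l', l < l' → l' ≤ s.nreg 3 → s.rreg 0 ≤ I.oracle (P l) (P l')
  fresh : ∀ e, s.nreg 5 ≤ e → s.narr 3 e = 0
  sound : ∀ e < s.nreg 5, 1 ≤ s.narr 3 e → s.narr 4 e < s.nreg 3 ∧ s.narr 5 e < I.m ∧
    s.narr 3 e - 1 < I.n ∧ I.col (s.narr 3 e - 1) = s.narr 5 e ∧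
    s.rarr 1 e = I.oracle (P (s.narr 4 e)) (s.narr 3 e - 1)
  complete : ∀ l < s.nreg 3, ∀ u < I.n, ∃ e < s.nreg 5, 1 ≤ s.narr 3 e ∧ s.narr 4 e = l ∧
    s.narr 5 e = I.col u ∧ s.rarr 1 e ≤ I.oracle (P l) u
  asg : ∀ l < s.nreg 3, s.narr 6 l < I.m ∧ I.col (s.narr 10 l) = s.narr 6 l
  cnt : ∀ i < I.m, s.narr 9 i = ((Finset.range (s.nreg 3)).filter fun l => s.narr 6 l = i).card

/-! ### Consequences of the invariant -/

theorem MainInv.pivotsCover_of_le {I : Problem} {P : ℕ → ℕ} {s : State} (h : MainInv I P s)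
    (hj : 1 ≤ s.nreg 3) {r : ℝ} (hr : s.rreg 0 ≤ 2 * r) {u : ℕ} (hu : u < I.n) :
    ∃ l < s.nreg 3, I.oracle u (P l) ≤ 2 * r := by
  obtain ⟨l, hl, he⟩ := (h.mindist hj u hu).1
  refine ⟨l, hl, ?_⟩
  rw [I.oracle_comm, ← he]
  exact ((h.far hj).2 u hu).trans hr

theorem MainInv.pivots_lt {I : Problem} {P : ℕ → ℕ} {s : State} (h : MainInv I P s) :
    ∀ l ≤ s.nreg 3, P l < I.n := by
  intro l hl
  rcases hl.lt_or_eq with hl | rfl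
  · exact h.pivot_lt l hl
  · rw [h.next_eq]
    exact h.next_lt

/-- The `k` matched pivots and the next one are `k + 1` points at mutual distance at least `s.rreg
0`, which therefore cannot exceed `2 * r`. -/
theorem MainInv.pivotsCover_of_eq {I : Problem} {P : ℕ → ℕ} {s : State} (h : MainInv I P s)
    (hk : 1 ≤ I.k) (hj : s.nreg 3 = I.k) : PivotsCover I P (s.nreg 3) := by
  intro T r hT u hu
  refine h.pivotsCover_of_le (by omega) (not_lt.1 fun hlt => ?_) hu
  refine hT.not_separated (hj ▸ h.pivots_lt) fun l l' hl hl' => ?_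
  exact hlt.trans_le (h.sep l l' hl (by omega))

/-- The edges to the classes include those of the next pivot. -/
structure EdgeInv (I : Problem) (P : ℕ → ℕ) (s : State) : Prop where
  sound : ∀ e < s.nreg 5 + I.m, 1 ≤ s.narr 3 e → s.narr 4 e ≤ s.nreg 3 ∧ s.narr 5 e < I.m ∧
    s.narr 3 e - 1 < I.n ∧ I.col (s.narr 3 e - 1) = s.narr 5 e ∧
    s.rarr 1 e = I.oracle (P (s.narr 4 e)) (s.narr 3 e - 1)
  complete : ∀ l ≤ s.nreg 3, ∀ u < I.n, ∃ e < s.nreg 5 + I.m, 1 ≤ s.narr 3 e ∧ s.narr 4 e = l ∧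
    s.narr 5 e = I.col u ∧ s.rarr 1 e ≤ I.oracle (P l) u
  fresh : ∀ e, s.nreg 5 + I.m ≤ e → s.narr 3 e = 0

theorem MainInv.row {I : Problem} {P : ℕ → ℕ} {s : State} (h : MainInv I P s) :
    Run I.oracle rowProg s (60 * I.n + 60) (EdgeInv I P) := by
  refine (rowProg_spec I.oracle s h.fresh).mono (by rw [h.n_eq]) ?_
  rintro s' hf ⟨hs, hc, hu⟩
  have g3 := hf.nreg 3 rfl
  have g5 := hf.nreg 5 rfl
  rw [h.n_eq, h.col_eq, ← h.next_eq] at hs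
  rw [h.n_eq, h.col_eq, ← h.next_eq] at hc
  refine ⟨?_, ?_, ?_⟩
  · intro e he hw
    rw [g3]
    rw [g5] at he
    rcases lt_or_ge e (s.nreg 5) with hlt | hge
    · obtain ⟨u3, u4, u5, u1⟩ := hu e hlt
      rw [u3] at hw
      rw [u3, u4, u5, u1]
      obtain ⟨h₁, h₂⟩ := h.sound e hlt hw
      exact ⟨h₁.le, h₂⟩
    · obtain ⟨w, hw, e3, -, e4, e5, e1⟩ := hs e hge hw
      rw [e3, e4, e5, e1, Nat.add_sub_cancel]
      exact ⟨le_rfl, I.col_lt hw, hw, rfl, rfl⟩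
  · intro l hl u hu'
    rw [g3] at hl
    rw [g5]
    rcases hl.lt_or_eq with hl | rfl
    · obtain ⟨e, he, h₁, h₂, h₃, h₄⟩ := h.complete l hl u hu'
      obtain ⟨u3, u4, u5, u1⟩ := hu e he
      exact ⟨e, by omega, by rwa [u3], by rwa [u4], by rwa [u5], by rwa [u1]⟩
    · have hlt := I.col_lt hu'
      obtain ⟨h₁, h₂⟩ := hc u hu'
      obtain ⟨w, hw, e3, ew, e4, e5, e1⟩ := hs _ (by omega) h₁
      exact ⟨_, by omega, h₁, e4, by omega, h₂⟩
  · intro e he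
    by_contra hne
    obtain ⟨w, hw, -, ew, -⟩ := hs e (by omega) (by omega)
    have := I.col_lt hw
    omega

/-- The shortest edge that leaves the reached classes is as short as the radius of any fair set,
unless the pivots found so far cover all points. -/
theorem MainInv.shortest_edge {I : Problem} {P : ℕ → ℕ} {s s' : State} (h : MainInv I P s)
    (hE : EdgeInv I P s') (g3 : s'.nreg 3 = s.nreg 3) (g1 : s'.nreg 1 = I.m)
    (a1 : s'.narr 1 = I.quo) (a9 : s'.narr 9 = s.narr 9)
    (r0 : s'.rreg 0 = s.rreg 0) (haj : s'.narr 6 (s.nreg 3) = I.m)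
    (ha : ∀ l < s.nreg 3, s'.narr 6 l = s.narr 6 l) :
    ∀ Q ⊆ Finset.range (s'.nreg 1), (∀ i ∈ Q, s'.narr 1 i ≤ s'.narr 9 i) →
      ∀ e < s'.nreg 5 + s'.nreg 1, LeavesSet s' Q e →
      (∀ e' < s'.nreg 5 + s'.nreg 1, LeavesSet s' Q e' → s'.rarr 1 e ≤ s'.rarr 1 e') →
      if 1 ≤ s'.nreg 3 ∧ ¬ s'.rarr 1 e + s'.rarr 1 e ≤ s'.rreg 0 then
        PivotsCover I P (s.nreg 3)
      else s'.narr 3 e - 1 < I.n ∧ ∀ T r, I.Cover T r →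
        I.oracle (P (s'.narr 4 e)) (s'.narr 3 e - 1) ≤ r := by
  intro Q hQ hfull e he hL hmin
  rw [g1] at hQ he hmin
  rw [a1, a9] at hfull
  rw [g3, r0]
  have hfull' : ∀ i ∈ Q,
      I.quo i ≤ ((Finset.range (s.nreg 3)).filter fun l => s'.narr 6 l = i).card := by
    intro i hi
    have := hfull i hi
    rw [h.cnt i (Finset.mem_range.1 (hQ hi))] at this
    rwa [Finset.filter_congr fun l hl => by rw [ha l (Finset.mem_range.1 hl)]]
  -- When the pivots are separated, counting gives a point within `r` outside `Q`. The stored edge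
  -- to its class is no longer, and `e` is shortest among the leaving edges.
  have key : ∀ T r, I.Cover T r →
      (∀ l l', l < l' → l' ≤ s.nreg 3 → 2 * r < I.oracle (P l) (P l')) → s'.rarr 1 e ≤ r := by
    intro T r hT hsep
    obtain ⟨l, hl, hal, u, hu, hle, hcol⟩ :=
      hT.exists_near h.pivots_lt haj hsep hQ hfull'
    obtain ⟨e', he', h₁, h₂, h₃, h₄⟩ := hE.complete l (by omega) u hu
    refine (hmin e' he' ⟨h₁, ?_, ?_⟩).trans (h₄.trans hle)
    · rwa [h₂, g1]
    · rwa [h₃]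
  obtain ⟨-, -, hlt, -, hD⟩ := hE.sound e he hL.1
  split_ifs with hc
  -- Giving up: if `2 * r` were below the separation, `key` would bound twice the edge by `2 * r`
  -- and the test would not have triggered.
  · intro T r hT u hu
    refine h.pivotsCover_of_le hc.1 (not_lt.1 fun hlt => hc.2 ?_) hu
    have := key T r hT fun l l' hl hl' => hlt.trans_le (h.sep l l' hl hl')
    linarith
  · refine ⟨hlt, fun T r hT => ?_⟩
    rw [← hD]
    -- Going on: the edge is at most `r` by the test itself if the separation is at most `2 * r`,
    -- and by `key` otherwise. With only one pivot, separation is vacuous.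
    by_cases hj : 1 ≤ s.nreg 3
    · by_cases hr : s.rreg 0 ≤ 2 * r
      · have : s'.rarr 1 e + s'.rarr 1 e ≤ s.rreg 0 := by
          by_contra h'
          exact hc ⟨hj, h'⟩
        linarith
      · exact key T r hT fun l l' hl hl' => (not_le.1 hr).trans_le (h.sep l l' hl hl')
    · exact key T r hT fun l l' hl hl' => by omega

theorem EdgeInv.congr {I : Problem} {P : ℕ → ℕ} {s s' : State} (h : EdgeInv I P s)
    (g3 : s'.nreg 3 = s.nreg 3) (g5 : s'.nreg 5 = s.nreg 5) (a3 : s'.narr 3 = s.narr 3)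
    (a4 : s'.narr 4 = s.narr 4) (a5 : s'.narr 5 = s.narr 5) (r1 : s'.rarr 1 = s.rarr 1) :
    EdgeInv I P s' := by
  obtain ⟨h₁, h₂, h₃⟩ := h
  constructor <;> simpa only [g3, g5, a3, a4, a5, r1]

/-- The point `w` is near the pivot `P l`. -/
def Near (I : Problem) (P : ℕ → ℕ) (l w : ℕ) : Prop :=
  w < I.n ∧ ∀ T r, I.Cover T r → I.oracle (P l) w ≤ r

/-- The search has found an augmenting path, or there is nothing left to do. -/
def SearchResult (I : Problem) (P : ℕ → ℕ) (j : ℕ) (s : State) : Prop :=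
  (1 ≤ s.nreg 6 ∧ PivotsCover I P j) ∨ (s.nreg 6 = 0 ∧ s.nreg 11 < I.m ∧
    1 ≤ s.narr 7 (s.nreg 11) ∧ s.narr 7 (s.nreg 11) ≤ I.m + 1 ∧
    s.narr 9 (s.nreg 11) < I.quo (s.nreg 11) ∧ Tree (Near I P) s)

theorem MainInv.prepare {I : Problem} {P : ℕ → ℕ} {s : State} (h : MainInv I P s)
    {T₀ : Finset ℕ} {r₀ : ℝ} (hT₀ : I.Cover T₀ r₀) (hj : s.nreg 3 < I.k) (h6 : s.nreg 6 = 0) :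
    Run I.oracle prepareProg s
      ((60 * I.n + 60) + ((20 * I.m + 20) + (20 + ((I.m + 1) * (60 * (I.k * I.m) + 200) + 3))))
      fun s' => EdgeInv I P s' ∧ s'.narr 6 = Function.update (s.narr 6) (s.nreg 3) I.m ∧
        SearchResult I P (s.nreg 3) s' := by
  refine Run.seq h.row fun s₁ f₁ hE₁ => ?_
  refine Run.seq ((clearProg_spec I.oracle s₁).mono
    (by rw [f₁.nreg 1 rfl, h.m_eq]) fun _ _ h => h) fun s₂ f₂ hQ₂ => ?_
  refine Run.seq (R := fun s' => s'.nreg 12 = 1 ∧ s'.nreg 13 = 0 ∧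
      s'.narr 6 = Function.update (s₂.narr 6) (s₂.nreg 3) (s₂.nreg 1) ∧
      s'.narr 7 = Function.update (s₂.narr 7) (s₂.nreg 1) 1)
    (Run.straight rfl (by decide) (by simp [startProg, Prog.final, NExp.eval]))
    fun s₃ f₃ ⟨h12, h13, e6, e7⟩ => ?_
  have hm₂ : s₂.nreg 1 = I.m := ((f₂.nreg 1 rfl).trans (f₁.nreg 1 rfl)).trans h.m_eq
  have hm₃ : s₃.nreg 1 = I.m := (f₃.nreg 1 rfl).trans hm₂
  have hj₂ : s₂.nreg 3 = s.nreg 3 := (f₂.nreg 3 rfl).trans (f₁.nreg 3 rfl)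
  have hj₃ : s₃.nreg 3 = s.nreg 3 := (f₃.nreg 3 rfl).trans hj₂
  have e6' : s₃.narr 6 = Function.update (s.narr 6) (s.nreg 3) I.m := by
    rw [e6, hm₂, hj₂, (f₂.narr 6 rfl).trans (f₁.narr 6 rfl)]
  have hE₃ : EdgeInv I P s₃ := hE₁.congr ((f₃.nreg 3 rfl).trans (f₂.nreg 3 rfl))
    ((f₃.nreg 5 rfl).trans (f₂.nreg 5 rfl)) ((f₃.narr 3 rfl).trans (f₂.narr 3 rfl))
    ((f₃.narr 4 rfl).trans (f₂.narr 4 rfl)) ((f₃.narr 5 rfl).trans (f₂.narr 5 rfl))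
    ((f₃.rarr 1 rfl).trans (f₂.rarr 1 rfl))
  have a1 : s₃.narr 1 = I.quo :=
    ((f₃.narr 1 rfl).trans ((f₂.narr 1 rfl).trans (f₁.narr 1 rfl))).trans h.quo_eq
  have a0 : s₃.narr 0 = I.col :=
    ((f₃.narr 0 rfl).trans ((f₂.narr 0 rfl).trans (f₁.narr 0 rfl))).trans h.col_eq
  have a9 : s₃.narr 9 = s.narr 9 := (f₃.narr 9 rfl).trans ((f₂.narr 9 rfl).trans (f₁.narr 9 rfl))
  have r0 : s₃.rreg 0 = s.rreg 0 := (f₃.rreg 0 rfl).trans ((f₂.rreg 0 rfl).trans (f₁.rreg 0 rfl))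
  have g5 : s₃.nreg 5 = s.nreg 5 := (f₃.nreg 5 rfl).trans ((f₂.nreg 5 rfl).trans (f₁.nreg 5 rfl))
  have haj : s₃.narr 6 (s.nreg 3) = I.m := by rw [e6', Function.update_self]
  have ha : ∀ l < s.nreg 3, s₃.narr 6 l = s.narr 6 l := fun l hl => by
    rw [e6', Function.update_of_ne hl.ne]
  refine (searchProg_spec I.oracle s₃ (Near I P) (PivotsCover I P (s.nreg 3)) ?_ h13 h12 ?_ ?_ ?_
    ?_ (h.shortest_edge hE₃ hj₃ hm₃ a1 a9 r0 haj ha)).mono ?_ ?_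
  · rw [(f₃.nreg 6 rfl).trans ((f₂.nreg 6 rfl).trans (f₁.nreg 6 rfl)), h6]
  · rw [e7, hm₃, hm₂, Function.update_self]
  · intro i hi
    rw [hm₃] at hi
    rw [e7, hm₂, Function.update_of_ne hi.ne]
    exact hQ₂ i (by rwa [f₁.nreg 1 rfl, h.m_eq])
  · intro e he hw
    rw [hm₃] at he ⊢
    obtain ⟨h₁, h₂, -, h₄, -⟩ := hE₃.sound e he hw
    refine ⟨h₁, ?_, h₂, by rw [a0, h₄]⟩
    rcases (h₁.trans hj₃.le).lt_or_eq with hl | hl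
    · rw [ha _ hl]
      exact (h.asg _ hl).1.le
    · rw [hl, haj]
  · intro Q hQ hfull
    rw [hm₃] at hQ ⊢
    rw [a1, a9] at hfull
    -- Fewer than `k` pivots are matched, so full classes cannot contain all of `T₀`. The new pivot
    -- has an edge to every nonempty class.
    obtain ⟨u, hu, hcol⟩ := hT₀.exists_not_mem (a := s.narr 6) hj hQ (fun i hi => by
      rw [← h.cnt i (Finset.mem_range.1 (hQ hi))]
      exact hfull i hi)
    obtain ⟨e, he, h₁, h₂, h₃, -⟩ := hE₃.complete (s.nreg 3) hj₃.ge u hu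
    exact ⟨e, he, h₁, Or.inl (by rw [h₂, haj, hm₃]), by rwa [h₃]⟩
  · rw [hm₃, g5, h.base_eq]
    have : s.nreg 3 * I.m + I.m ≤ I.k * I.m := by
      rw [← Nat.succ_mul]
      exact Nat.mul_le_mul_right _ hj
    gcongr
  · intro s' f₄ hR
    refine ⟨hE₃.congr (f₄.nreg 3 rfl) (f₄.nreg 5 rfl) (f₄.narr 3 rfl) (f₄.narr 4 rfl)
      (f₄.narr 5 rfl) (f₄.rarr 1 rfl), (f₄.narr 6 rfl).trans e6', ?_⟩
    rw [SearchResult, f₄.narr 9 rfl]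
    rwa [hm₃, a1] at hR

/-! ### Extending the assignment by one pivot -/

theorem load_update_last (a : ℕ → ℕ) (j : ℕ) {m c : ℕ} (hc : c < m) :
    load (Function.update a j m) j c = ((Finset.range j).filter fun l => a l = c).card := by
  rw [load, Finset.range_add_one, Finset.filter_insert, Function.update_self, if_neg hc.ne']
  congr 1
  exact Finset.filter_congr fun l hl => by
    rw [Function.update_of_ne (Finset.mem_range.1 hl).ne]

theorem load_update_last_self {a : ℕ → ℕ} {j m : ℕ} (ha : ∀ l < j, a l < m) :
    load (Function.update a j m) j m = 1 := by
  rw [load, Finset.range_add_one, Finset.filter_insert, Function.update_self, if_pos rfl,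
    Finset.filter_eq_empty_iff.2, insert_empty_eq, Finset.card_singleton]
  intro l hl
  have hl := Finset.mem_range.1 hl
  rw [Function.update_of_ne hl.ne]
  exact (ha l hl).ne

/-- Assigning the next pivot along the path that was found preserves the invariant. -/
theorem MainInv.advance {I : Problem} {P : ℕ → ℕ} {s s₀ : State} (h : MainInv I P s)
    (hf : Frame prepareProg s s₀) (hj : s.nreg 3 < I.k) (hE : EdgeInv I P s₀)
    (h6 : s₀.narr 6 = Function.update (s.narr 6) (s.nreg 3) I.m)
    (hres : s₀.nreg 6 = 0 ∧ s₀.nreg 11 < I.m ∧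
      1 ≤ s₀.narr 7 (s₀.nreg 11) ∧ s₀.narr 7 (s₀.nreg 11) ≤ I.m + 1 ∧
      s₀.narr 9 (s₀.nreg 11) < I.quo (s₀.nreg 11) ∧ Tree (Near I P) s₀) :
    Run I.oracle advanceProg s₀ (10 + ((60 * (I.m + 1) + 60) + ((60 * I.n + 60) + 20)))
      fun s' => s'.nreg 6 = 0 ∧ s'.nreg 3 = s.nreg 3 + 1 ∧ ∃ P', MainInv I P' s' := by
  obtain ⟨hhalt, hi, hi1, him, hfree, hT⟩ := hres
  set i := s₀.nreg 11 with hidef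
  refine Run.seq (R := fun s' => s'.nreg = s₀.nreg ∧
      s'.narr 9 = Function.update (s₀.narr 9) i (s₀.narr 9 i + 1))
    (Run.straight rfl (by decide) (by simp [Prog.final, NExp.eval, hidef]))
    fun s₁ f₁ ⟨hreg, e9⟩ => ?_
  have j₀ := hf.nreg 3 rfl
  have j₁ : s₁.nreg 3 = s.nreg 3 := by rw [hreg, j₀]
  have m₁ : s₁.nreg 1 = I.m := by rw [hreg, hf.nreg 1 rfl, h.m_eq]
  have c₁ : s₁.narr 0 = I.col := by rw [f₁.narr 0 rfl, hf.narr 0 rfl, h.col_eq]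
  have w₁ : s₁.narr 10 = s.narr 10 := by rw [f₁.narr 10 rfl, hf.narr 10 rfl]
  have a₁ : s₁.narr 6 = Function.update (s.narr 6) (s.nreg 3) I.m := by rw [f₁.narr 6 rfl, h6]
  have q₁ : s₁.narr 7 = s₀.narr 7 := f₁.narr 7 rfl
  have i₁ : s₁.nreg 11 = i := by rw [hreg]
  refine Run.seq ((flipProg_spec I.oracle s₁ (Near I P) ?_ ?_ ?_ ?_ ?_).mono ?_ fun _ _ h => h)
    fun s₂ f₂ ⟨hasg, hload⟩ => ?_
  · unfold Tree at hT ⊢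
    rwa [hreg, q₁, f₁.narr 0 rfl, f₁.narr 3 rfl, f₁.narr 4 rfl, f₁.narr 6 rfl, f₁.narr 8 rfl]
  · intro l hl
    rw [j₁] at hl
    rw [a₁, m₁, c₁, w₁]
    rcases hl.lt_or_eq with hl | rfl
    · rw [Function.update_of_ne hl.ne]
      exact ⟨(h.asg l hl).1.le, fun _ => ⟨(h.asg l hl).2, h.near l hl⟩⟩
    · simp
  · rwa [i₁, m₁]
  · rwa [i₁, q₁]
  · rw [a₁, m₁, j₁]
    exact load_update_last_self fun l hl => (h.asg l hl).1
  · rw [q₁, i₁]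
    omega
  rw [j₁, m₁, c₁] at hasg
  rw [j₁, m₁, i₁, a₁] at hload
  have hload' : ∀ c < I.m, load (s₂.narr 6) (s.nreg 3) c =
      s.narr 9 c + if c = i then 1 else 0 := by
    intro c hc
    rw [hload c hc, load_update_last _ _ hc, h.cnt c hc]
  have n₂ : s₂.nreg 0 = I.n := by rw [f₂.nreg 0 rfl, hreg, hf.nreg 0 rfl, h.n_eq]
  have j₂ : s₂.nreg 3 = s.nreg 3 := by rw [f₂.nreg 3 rfl, j₁]
  have p₂ : s₂.nreg 4 = P (s.nreg 3) := by
    rw [f₂.nreg 4 rfl, hreg, hf.nreg 4 rfl, h.next_eq]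
  have d₂ : s₂.rarr 0 = s.rarr 0 := by rw [f₂.rarr 0 rfl, f₁.rarr 0 rfl, hf.rarr 0 rfl]
  refine Run.seq ((nextProg_spec I.oracle s₂ I.oracle_nonneg ?_ ?_).mono (by rw [n₂])
    fun _ _ h => h) fun s₃ f₃ ⟨hmd, ⟨hq, hrho⟩, hfar⟩ => ?_
  · rw [n₂]
    have := h.next_lt
    omega
  · intro h1 u hu
    obtain ⟨l, -, e⟩ := (h.mindist (j₂ ▸ h1) u (n₂ ▸ hu)).1
    rw [d₂, e]
    exact I.oracle_nonneg _ _
  rw [n₂, j₂, p₂, d₂] at hmd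
  rw [n₂] at hq hfar
  set q := s₃.nreg 14 with hqdef
  refine Run.straight rfl (by decide) ?_
  set s₄ := stepProg.final I.oracle s₃ with hs₄
  have e3 : s₄.nreg 3 = s.nreg 3 + 1 := by
    have := f₃.nreg 3 rfl
    simp [hs₄, stepProg, Prog.final, NExp.eval, this, j₂]
  have e4 : s₄.nreg 4 = q := by
    simp [hs₄, stepProg, Prog.final, NExp.eval, hqdef]
  have e5 : s₄.nreg 5 = s.nreg 5 + I.m := by
    have h5 := f₃.nreg 5 rfl
    have h1 := f₃.nreg 1 rfl
    simp [hs₄, stepProg, Prog.final, NExp.eval, h5, h1, f₂.nreg 5 rfl, f₂.nreg 1 rfl, m₁, hreg,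
      hf.nreg 5 rfl]
  have f₄ : Frame stepProg s₃ s₄ := by
    obtain ⟨t, -, he⟩ := stepProg.exists_exec_final I.oracle rfl s₃
    exact he.frame
  have b3 : s₄.narr 3 = s₀.narr 3 := by
    rw [f₄.narr 3 rfl, f₃.narr 3 rfl, f₂.narr 3 rfl, f₁.narr 3 rfl]
  have b4 : s₄.narr 4 = s₀.narr 4 := by
    rw [f₄.narr 4 rfl, f₃.narr 4 rfl, f₂.narr 4 rfl, f₁.narr 4 rfl]
  have b5 : s₄.narr 5 = s₀.narr 5 := by
    rw [f₄.narr 5 rfl, f₃.narr 5 rfl, f₂.narr 5 rfl, f₁.narr 5 rfl]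
  have b6 : s₄.narr 6 = s₂.narr 6 := by rw [f₄.narr 6 rfl, f₃.narr 6 rfl]
  have b9 : s₄.narr 9 = Function.update (s.narr 9) i (s.narr 9 i + 1) := by
    rw [f₄.narr 9 rfl, f₃.narr 9 rfl, f₂.narr 9 rfl, e9, hf.narr 9 rfl]
  have b10 : s₄.narr 10 = s₂.narr 10 := by rw [f₄.narr 10 rfl, f₃.narr 10 rfl]
  have b1 : s₄.rarr 1 = s₀.rarr 1 := by
    rw [f₄.rarr 1 rfl, f₃.rarr 1 rfl, f₂.rarr 1 rfl, f₁.rarr 1 rfl]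
  have bd : s₄.rarr 0 = s₃.rarr 0 := f₄.rarr 0 rfl
  have br : s₄.rreg 0 = s₃.rreg 0 := f₄.rreg 0 rfl
  have g5 : s₀.nreg 5 = s.nreg 5 := hf.nreg 5 rfl
  -- The sequence of pivots exists only in the proof; the machine stores just the next one.
  set P' := Function.update P (s.nreg 3 + 1) q with hP'
  have P'eq : ∀ l ≤ s.nreg 3, P' l = P l := fun l hl => Function.update_of_ne (by omega) _ _
  have hcnt : ∀ c < I.m, s₄.narr 9 c =
      ((Finset.range (s.nreg 3 + 1)).filter fun l => s₂.narr 6 l = c).card := by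
    intro c hc
    rw [b9, ← load, hload' c hc, Function.update_apply]
    split_ifs with hci
    · rw [hci]
    · rfl
  have hmd' : ∀ u < I.n, (∃ l < s.nreg 3 + 1, s₃.rarr 0 u = I.oracle (P l) u) ∧
      ∀ l < s.nreg 3 + 1, s₃.rarr 0 u ≤ I.oracle (P l) u := by
    intro u hu
    rw [hmd u hu]
    split_ifs with h0
    · refine ⟨⟨s.nreg 3, by omega, rfl⟩, fun l hl => ?_⟩
      rw [show l = s.nreg 3 by omega]
    · obtain ⟨⟨l, hl, he⟩, hall⟩ := h.mindist (by omega) u hu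
      constructor
      · rcases min_choice (s.rarr 0 u) (I.oracle (P (s.nreg 3)) u) with h' | h'
        · exact ⟨l, by omega, by rw [h', he]⟩
        · exact ⟨_, by omega, h'⟩
      · intro l hl
        rcases Nat.lt_succ_iff_lt_or_eq.1 hl with hl | rfl
        · exact (min_le_left _ _).trans (hall l hl)
        · exact min_le_right _ _
  refine ⟨?_, e3, P', ⟨?_, ?_, ?_, ?_, ?_, ?_, ?_, ?_, ?_, ?_⟩, ?_, ?_, ?_, ?_, ?_, ?_, ?_, ?_, ?_,
    ?_, ?_⟩
  · rw [f₄.nreg 6 rfl, f₃.nreg 6 rfl, f₂.nreg 6 rfl, hreg, hhalt]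
  · rw [f₄.nreg 0 rfl, f₃.nreg 0 rfl, n₂]
  · rw [f₄.nreg 1 rfl, f₃.nreg 1 rfl, f₂.nreg 1 rfl, m₁]
  · rw [f₄.nreg 2 rfl, f₃.nreg 2 rfl, f₂.nreg 2 rfl, hreg, hf.nreg 2 rfl, h.k_eq]
  · rw [f₄.narr 0 rfl, f₃.narr 0 rfl, f₂.narr 0 rfl, c₁]
  · rw [f₄.narr 1 rfl, f₃.narr 1 rfl, f₂.narr 1 rfl, f₁.narr 1 rfl, hf.narr 1 rfl, h.quo_eq]
  · omega
  · intro l hl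
    rw [P'eq l (by omega)]
    exact h.pivots_lt l (by omega)
  · intro l hl
    rw [P'eq l (by omega), b10]
    exact (hasg l (by omega)).2.2
  · intro c
    rw [e3, b10, Finset.filter_congr (q := fun l => s₂.narr 6 l = c) fun l hl => by
      rw [(hasg l (by have := Finset.mem_range.1 hl; omega)).2.1]]
    rcases lt_or_ge c I.m with hc | hc
    · rw [← load, hload' c hc]
      split_ifs with hci
      · rw [hf.narr 9 rfl] at hfree
        rw [hci]
        exact hfree
      · rw [h.cnt c hc, ← Finset.filter_congr (p := fun l => I.col (s.narr 10 l) = c)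
          fun l hl => by rw [(h.asg l (Finset.mem_range.1 hl)).2]]
        exact h.cap c
    · rw [Finset.filter_eq_empty_iff.2, Finset.card_empty]
      · exact Nat.zero_le _
      · intro l hl
        have := (hasg l (by have := Finset.mem_range.1 hl; omega)).1
        omega
  · rw [f₄.nreg 17 rfl, f₃.nreg 17 rfl, f₂.nreg 17 rfl, hreg, hf.nreg 17 rfl, f₄.narr 11 rfl,
      f₃.narr 11 rfl, f₂.narr 11 rfl, f₁.narr 11 rfl, hf.narr 11 rfl, f₄.narr 12 rfl,
      f₃.narr 12 rfl, f₂.narr 12 rfl, f₁.narr 12 rfl, hf.narr 12 rfl]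
    exact h.out
  · rw [e5, e3, h.base_eq, Nat.succ_mul]
  · rw [e3, e4, hP', Function.update_self]
  · rwa [e4]
  · intro _ u hu
    rw [e3, bd]
    obtain ⟨⟨l, hl, he⟩, hall⟩ := hmd' u hu
    exact ⟨⟨l, hl, by rw [he, P'eq l (by omega)]⟩, fun l hl => by
      rw [P'eq l (by omega)]
      exact hall l hl⟩
  · intro _
    rw [br, bd, e4]
    exact ⟨hrho, hfar⟩
  · intro l l' hll hl'
    rw [e3] at hl'
    rw [br, P'eq l (by omega)]
    rcases hl'.lt_or_eq with hl' | rfl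
    · rw [P'eq l' (by omega)]
      -- The farthest distance can only drop when a pivot is added, so old pairs remain separated by
      -- the new value.
      refine le_trans ?_ (h.sep l l' hll (by omega))
      rw [hrho, hmd q hq, if_neg (by omega)]
      exact (min_le_left _ _).trans ((h.far (by omega)).2 q hq)
    · rw [hP', Function.update_self, hrho]
      exact (hmd' q hq).2 l hll
  · intro e he
    rw [b3]
    exact hE.fresh e (by omega)
  · intro e he hw
    rw [b3] at hw
    rw [b3, b4, b5, b1, e3]
    obtain ⟨h₁, h₂, h₃, h₄, h₅⟩ := hE.sound e (by omega) hw
    refine ⟨by omega, h₂, h₃, h₄, ?_⟩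
    rw [h₅, P'eq _ (by omega)]
  · intro l hl u hu
    rw [P'eq l (by omega), b3, b4, b5, b1]
    obtain ⟨e, he, h'⟩ := hE.complete l (by omega) u hu
    exact ⟨e, by omega, h'⟩
  · intro l hl
    rw [b6, b10]
    obtain ⟨h₁, h₂, -⟩ := hasg l (by omega)
    exact ⟨h₁, h₂⟩
  · intro c hc
    rw [e3, b6]
    exact hcnt c hc

/-- A bound for the running time of one round of the main loop. -/
def roundTime (I : Problem) : ℕ :=
  120 * I.n + 80 * I.m + (I.m + 1) * (60 * (I.k * I.m) + 200) + 316

theorem MainInv.round {I : Problem} {P : ℕ → ℕ} {s : State} (h : MainInv I P s)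
    {T₀ : Finset ℕ} {r₀ : ℝ} (hT₀ : I.Cover T₀ r₀) (hj : s.nreg 3 < I.k) (h6 : s.nreg 6 = 0) :
    Run I.oracle mainBody s (roundTime I) fun s' =>
      (s'.nreg 6 = 0 ∧ s'.nreg 3 = s.nreg 3 + 1 ∧ ∃ P', MainInv I P' s') ∨
      (1 ≤ s'.nreg 6 ∧ Core I P s' ∧ PivotsCover I P (s'.nreg 3)) := by
  refine (Run.seq (h.prepare hT₀ hj h6) fun s₁ f₁ ⟨hE, ha, hres⟩ =>
    Run.ite (T := 10 + ((60 * (I.m + 1) + 60) + ((60 * I.n + 60) + 20))) ?_ ?_).mono ?_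
    fun _ _ h => h
  · intro hb
    simp only [BExp.eval, NExp.eval, Nat.le_zero] at hb
    rcases hres with ⟨h', -⟩ | h'
    · omega
    · exact (h.advance f₁ hj hE ha h').mono le_rfl fun _ _ h => Or.inl h
  · intro hb
    simp only [BExp.eval, NExp.eval, Nat.le_zero] at hb
    rcases hres with ⟨h', hZ⟩ | h'
    · refine Run.straight rfl (by simp only [Prog.time]; omega) (Or.inr ⟨h', ?_, ?_⟩)
      · change Core I P s₁
        have j₁ := f₁.nreg 3 rfl
        have w₁ := f₁.narr 10 rfl
        refine ⟨?_, ?_, ?_, ?_, ?_, ?_, ?_, ?_, ?_, ?_⟩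
        · rw [f₁.nreg 0 rfl, h.n_eq]
        · rw [f₁.nreg 1 rfl, h.m_eq]
        · rw [f₁.nreg 2 rfl, h.k_eq]
        · rw [f₁.narr 0 rfl, h.col_eq]
        · rw [f₁.narr 1 rfl, h.quo_eq]
        · rw [j₁]
          exact h.j_le
        · rw [j₁]
          exact h.pivot_lt
        · rw [j₁, w₁]
          exact h.near
        · rw [j₁, w₁]
          exact h.cap
        · rw [f₁.nreg 17 rfl, f₁.narr 11 rfl, f₁.narr 12 rfl]
          exact h.out
      · rw [Prog.final, f₁.nreg 3 rfl]
        exact hZ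
    · exact absurd h'.1 hb
  · rw [roundTime, show BExp.cost (.nle (.reg 6) (.const 0)) = 3 from rfl]
    omega

/-- The alternative `I.k = 1` describes the entry with the flag already set, where no pivot has been
matched and nothing is covered. -/
theorem mainLoop_spec (I : Problem) (s : State) {T₀ : Finset ℕ} {r₀ : ℝ} (hT₀ : I.Cover T₀ r₀)
    (hk : 1 ≤ I.k) (h : (s.nreg 6 = 0 ∧ ∃ P, MainInv I P s) ∨
      (1 ≤ s.nreg 6 ∧ ∃ P, Core I P s ∧ (PivotsCover I P (s.nreg 3) ∨ I.k = 1))) :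
    Run I.oracle mainLoop s
      ((if s.nreg 6 = 0 then I.k - s.nreg 3 else 0) * (8 + roundTime I) + 8)
      fun s' => ∃ P, Core I P s' ∧ (PivotsCover I P (s'.nreg 3) ∨ I.k = 1) := by
  refine (Run.loop (P := mainBody) (T := roundTime I)
    (v := fun s => if s.nreg 6 = 0 then I.k - s.nreg 3 else 0)
    (R := fun s => (s.nreg 6 = 0 ∧ ∃ P, MainInv I P s) ∨
      (1 ≤ s.nreg 6 ∧ ∃ P, Core I P s ∧ (PivotsCover I P (s.nreg 3) ∨ I.k = 1))) h ?_).mono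
      le_rfl ?_
  · rintro s' - hR ⟨hb, hb'⟩
    simp only [BExp.eval, NExp.eval, Nat.le_zero, not_le] at hb hb'
    rcases hR with ⟨h6, P, hP⟩ | ⟨h6, -⟩
    · rw [hP.k_eq] at hb
      refine (hP.round hT₀ hb h6).mono le_rfl fun s'' _ hR => ?_
      rw [if_pos h6]
      rcases hR with ⟨h6', h3, hP'⟩ | ⟨h6', hc, hZ⟩
      · refine ⟨Or.inl ⟨h6', hP'⟩, ?_⟩
        rw [if_pos h6', h3]
        omega
      · refine ⟨Or.inr ⟨h6', P, hc, Or.inl hZ⟩, ?_⟩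
        rw [if_neg (by omega)]
        omega
    · omega
  · rintro s' - ⟨hR, hb⟩
    rcases hR with ⟨h6, P, hP⟩ | ⟨-, hP⟩
    · refine ⟨P, hP.toCore, Or.inl (hP.pivotsCover_of_eq hk ?_)⟩
      simp only [BExp.eval, NExp.eval, h6, hP.k_eq] at hb
      have := hP.j_le
      omega
    · exact hP

/-! ### The program and its analysis -/

/-- The complete program. For `k = 1` the main loop is not entered. -/
def fairProg : Prog :=
  -- Truncated subtraction sets the flag exactly for `k ≤ 1`. Since `log 1 = 0`, only `O(n)` time is
  -- allowed for `k = 1`, and `m` may be much larger than `n`, so even clearing an array of length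
  -- `m` would be too slow.
  .seq (.nset 6 (.sub (.const 2) (.reg 2))) (.seq mainLoop (.seq selectProg completeProg))

namespace Problem

variable {I : Problem}

theorem core_start {s : State} (hs : s = (Prog.nset 6 (.sub (.const 2) (.reg 2))).final I.oracle
    I.input) : Core I (fun _ => 0) s := by
  subst hs
  refine ⟨?_, ?_, ?_, rfl, rfl, ?_, ?_, ?_, ?_, ?_⟩ <;> simp [Prog.final, input]

theorem mainInv_start {s : State} (hs : s = (Prog.nset 6 (.sub (.const 2) (.reg 2))).final I.oracle
    I.input) (hn : 0 < I.n) : MainInv I (fun _ => 0) s := by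
  refine ⟨core_start hs, ?_, ?_, ?_, ?_, ?_, ?_, ?_, ?_, ?_, ?_, ?_⟩ <;> subst hs
  · simp [Prog.final, input]
  · simp [Prog.final, input]
  · simpa [Prog.final, input] using hn
  · simp [Prog.final, input]
  · simp [Prog.final, input]
  · intro l l' hl hl'
    have : l' = 0 := by simpa [Prog.final, input] using hl'
    omega
  all_goals simp [Prog.final, input]

/-- A fair set of points, as a set of indices. -/
theorem cover_of_isFair {T : Finset (Fin I.n)} (hk : 1 ≤ I.k) (hT : I.IsFair T) :
    I.Cover (T.map Fin.valEmbedding) (I.radius T) := by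
  have hfair : ∀ i < I.m,
      ((T.map Fin.valEmbedding).filter fun u => I.col u = i).card = I.quo i := by
    intro i hi
    rw [show i = ((⟨i, hi⟩ : Fin I.m) : ℕ) from rfl, quo_val, ← hT ⟨i, hi⟩, Finset.filter_map,
      Finset.card_map]
    congr 1
    refine Finset.filter_congr fun u _ => ?_
    simp [col_val, Fin.ext_iff]
  refine ⟨?_, hfair, ?_⟩
  · intro u hu
    obtain ⟨v, -, rfl⟩ := Finset.mem_map.1 hu
    exact Finset.mem_range.2 v.2
  -- Over an empty set the real infimum is `0` by convention and no center attains it; `1 ≤ k`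
  -- excludes this.
  · have hne : T.Nonempty := by
      rw [Finset.nonempty_iff_ne_empty]
      rintro rfl
      have : I.k = 0 := by
        rw [← sum_quo]
        refine Finset.sum_eq_zero fun i hi => ?_
        rw [← hfair i (Finset.mem_range.1 hi)]
        simp
      omega
    have : Nonempty T := hne.to_subtype
    intro u hu
    obtain ⟨t, ht⟩ := exists_eq_ciInf_of_finite (f := fun t : T => I.dist ⟨u, hu⟩ t)
    refine ⟨(t : Fin I.n), Finset.mem_map_of_mem _ t.2, ?_⟩
    have h := le_ciSup (f := fun u : Fin I.n => ⨅ t : T, I.dist u t)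
      (Set.finite_range _).bddAbove ⟨u, hu⟩
    rw [show u = ((⟨u, hu⟩ : Fin I.n) : ℕ) from rfl, oracle_val]
    exact ht.trans_le h

theorem radius_le {S : Finset (Fin I.n)} {r : ℝ} (hn : 0 < I.n)
    (h : ∀ u < I.n, ∃ t ∈ S.map Fin.valEmbedding, I.oracle u t ≤ r) : I.radius S ≤ r := by
  have : Nonempty (Fin I.n) := ⟨⟨0, hn⟩⟩
  refine ciSup_le fun u => ?_
  obtain ⟨t, ht, hle⟩ := h u u.2
  obtain ⟨v, hv, rfl⟩ := Finset.mem_map.1 ht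
  rw [Fin.valEmbedding_apply, oracle_val] at hle
  exact ciInf_le_of_le (Set.finite_range _).bddBelow ⟨v, hv⟩ hle

/-- A set of indices that contains the assigned points and respects the quotas is a good
solution. -/
theorem Cover.approx {T S : Finset ℕ} {r : ℝ} (hT : I.Cover T r) (hSn : S ⊆ Finset.range I.n)
    (hfair : ∀ i < I.m, (S.filter fun u => I.col u = i).card = I.quo i) {P : ℕ → ℕ} {s : State}
    (hc : Core I P s) (hS : ∀ l < s.nreg 3, s.narr 10 l ∈ S)
    (hZ : PivotsCover I P (s.nreg 3) ∨ I.k = 1) : I.Cover S (3 * r) := by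
  refine ⟨hSn, hfair, fun u hu => ?_⟩
  rcases hZ with hZ | hk
  · obtain ⟨l, hl, hle⟩ := hZ T r hT u hu
    refine ⟨_, hS l hl, ?_⟩
    have h₁ := oracle_triangle hu (hc.near l hl).1 (hc.pivot_lt l hl)
    have h₂ := (hc.near l hl).2 T r hT
    linarith
  -- Both sets are singletons, and passing through the center in `T` gives `2 * r`, which is at most
  -- `3 * r` because `r` is nonnegative.
  · have hScard : S.card = 1 := by
      rw [← hk, ← sum_quo, ← Finset.sum_congr rfl fun i hi => hfair i (Finset.mem_range.1 hi),
        Finset.sum_card_fiberwise_eq_card_filter, Finset.filter_true_of_mem]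
      exact fun v hv => Finset.mem_range.2 (col_lt (Finset.mem_range.1 (hSn hv)))
    obtain ⟨x, rfl⟩ := Finset.card_eq_one.1 hScard
    obtain ⟨y, rfl⟩ := Finset.card_eq_one.1 (hT.card_eq.trans hk)
    have hx : x < I.n := Finset.mem_range.1 (hSn (Finset.mem_singleton_self x))
    have hy : y < I.n := Finset.mem_range.1 (hT.subset (Finset.mem_singleton_self y))
    obtain ⟨t, ht, h₁⟩ := hT.cover u hu
    obtain ⟨t', ht', h₂⟩ := hT.cover x hx
    rw [Finset.mem_singleton] at ht ht'
    subst ht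
    subst ht'
    refine ⟨x, Finset.mem_singleton_self x, ?_⟩
    have h₃ := oracle_triangle hu hx hy
    rw [oracle_comm] at h₂
    have h₄ := I.oracle_nonneg t' x
    linarith

end Problem

theorem fairProg_spec (I : Problem) (hk : 1 ≤ I.k) (hT : ∃ T, I.IsFair T) :
    Run I.oracle fairProg I.input
      (4 + (((if 2 ≤ I.k then I.k else 0) * (8 + roundTime I) + 8) +
        ((60 * I.k + 60) + (60 * I.n + 60))))
      fun s => ∃ S, I.Outputs s S ∧ I.IsApprox 3 S := by
  obtain ⟨T₀, hT₀⟩ := hT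
  have hC₀ := I.cover_of_isFair hk hT₀
  have hn : 0 < I.n := by
    obtain ⟨t, ht⟩ := Finset.card_pos.1 (hk.trans hC₀.card_eq.ge)
    have := Finset.mem_range.1 (hC₀.subset ht)
    omega
  refine Run.seq (R := fun s => s = (Prog.nset 6 (.sub (.const 2) (.reg 2))).final I.oracle I.input)
    (Run.straight rfl le_rfl rfl) fun s₁ _ hs₁ => ?_
  have h6 : s₁.nreg 6 = 2 - I.k := by simp [hs₁, Prog.final, NExp.eval, Problem.input]
  have h3 : s₁.nreg 3 = 0 := by simp [hs₁, Prog.final, Problem.input]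
  refine Run.seq ((mainLoop_spec I s₁ hC₀ hk ?_).mono ?_ fun _ _ h => h)
    fun s₂ _ ⟨P, hc, hZ⟩ => ?_
  · by_cases h2 : 2 ≤ I.k
    · exact Or.inl ⟨by omega, _, I.mainInv_start hs₁ hn⟩
    · exact Or.inr ⟨by omega, _, I.core_start hs₁, Or.inr (by omega)⟩
  · refine Nat.add_le_add_right (Nat.mul_le_mul_right _ ?_) _
    split_ifs <;> omega
  have hcap := hc.cap
  rw [← hc.col_eq, ← hc.quo_eq] at hcap
  refine Run.seq ((selectProg_spec I.oracle s₂ hc.out.1 hc.out.2.1 hc.out.2.2 hcap).mono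
    (by have := hc.j_le; omega) fun _ _ h => h) fun s₃ f₃ hH => ?_
  have n₃ : s₃.nreg 0 = I.n := (f₃.nreg 0 rfl).trans hc.n_eq
  have c₃ : s₃.narr 0 = I.col := (f₃.narr 0 rfl).trans hc.col_eq
  have q₃ : s₃.narr 1 = I.quo := (f₃.narr 1 rfl).trans hc.quo_eq
  refine (completeProg_spec I.oracle s₃ _ hH ?_).mono (by rw [n₃]) ?_
  · intro u hu
    obtain ⟨l, hl, rfl⟩ := Finset.mem_image.1 hu
    rw [n₃]
    exact Finset.mem_range.2 (hc.near l (Finset.mem_range.1 hl)).1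
  · rintro s₄ f₄ ⟨S, hS, hsub, hSn, hmax⟩
    rw [n₃] at hSn hmax
    rw [c₃, q₃] at hmax
    have c₄ : s₄.narr 0 = I.col := (f₄.narr 0 rfl).trans c₃
    have q₄ : s₄.narr 1 = I.quo := (f₄.narr 1 rfl).trans q₃
    have hfair : ∀ i < I.m, (S.filter fun u => I.col u = i).card = I.quo i := by
      intro i hi
      have hle := hS.2.1 i
      rw [hle.1, c₄, q₄] at hle
      refine le_antisymm hle.2 ?_
      -- If the class were short of its quota, maximality would put all its points into `S`, in
      -- particular the `quota i` points of the fair set `T₀`.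
      by_contra hlt
      refine hlt ?_
      rw [← hC₀.fair i hi]
      refine Finset.card_le_card fun u hu => ?_
      obtain ⟨huT, rfl⟩ := Finset.mem_filter.1 hu
      refine Finset.mem_filter.2 ⟨?_, rfl⟩
      exact (hmax u (Finset.mem_range.1 (hC₀.subset huT))).resolve_right hlt
    have happrox : ∀ T r, I.Cover T r → I.Cover S (3 * r) := fun T r hT =>
      hT.approx hSn hfair hc
        (fun l hl => hsub (Finset.mem_image_of_mem _ (Finset.mem_range.2 hl))) hZ
    have hmap : (Finset.univ.filter fun u : Fin I.n => (u : ℕ) ∈ S).map Fin.valEmbedding = S := by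
      ext u
      simp only [Finset.mem_map, Finset.mem_filter, Finset.mem_univ, true_and,
        Fin.valEmbedding_apply]
      constructor
      · rintro ⟨v, hv, rfl⟩
        exact hv
      · exact fun hu => ⟨⟨u, Finset.mem_range.1 (hSn hu)⟩, hu, rfl⟩
    refine ⟨Finset.univ.filter fun u : Fin I.n => (u : ℕ) ∈ S, ?_, ?_, ?_⟩
    · rw [Problem.Outputs, hmap, ← (happrox _ _ hC₀).card_eq]
      exact hS.2.2.2
    · intro i
      rw [← I.quo_val i, ← hfair i i.2, ← hmap, Finset.filter_map, Finset.card_map, hmap]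
      congr 1
      refine Finset.filter_congr fun u _ => ?_
      simp [I.col_val, Fin.ext_iff]
    · intro T hT
      refine I.radius_le hn fun u hu => ?_
      rw [hmap]
      exact (happrox _ _ (I.cover_of_isFair hk hT)).cover u hu

theorem total_time_le (I : Problem) (hk : 1 ≤ I.k) (hn : 1 ≤ I.n) (hm : 1 ≤ I.m) :
    4 + (((if 2 ≤ I.k then I.k else 0) * (8 + roundTime I) + 8) +
      ((60 * I.k + 60) + (60 * I.n + 60))) ≤
    500 * (I.k * I.n) + if 2 ≤ I.k then 1100 * (I.m ^ 2 * I.k ^ 2) else 0 := by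
  have hkn : I.k ≤ I.k * I.n := Nat.le_mul_of_pos_right _ hn
  have hnk : I.n ≤ I.k * I.n := Nat.le_mul_of_pos_left _ hk
  split_ifs with h2
  -- Everything except the linear term in `n` is absorbed into `k * m ^ 2`, using `1 ≤ k` and `1 ≤
  -- m`.
  · have hround : 8 + roundTime I ≤ 120 * I.n + 1100 * (I.k * I.m ^ 2) := by
      have h₁ : I.m ≤ I.k * I.m ^ 2 := by nlinarith [Nat.mul_le_mul hk (Nat.mul_le_mul hm hm)]
      have h₂ : (I.m + 1) * (60 * (I.k * I.m) + 200) ≤ 520 * (I.k * I.m ^ 2) := by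
        have h₃ : 1 ≤ I.k * I.m := Nat.mul_pos hk hm
        calc _ ≤ (2 * I.m) * (260 * (I.k * I.m)) := Nat.mul_le_mul (by omega) (by omega)
          _ = 520 * (I.k * I.m ^ 2) := by ring
      rw [roundTime]
      omega
    have := Nat.mul_le_mul_left I.k hround
    have e : I.k * (120 * I.n + 1100 * (I.k * I.m ^ 2)) =
      120 * (I.k * I.n) + 1100 * (I.m ^ 2 * I.k ^ 2) := by ring
    omega
  · omega

end FairKCenter

theorem mainTheorem9 :
    ∃ (P : FairKCenter.Prog) (C : ℝ), ∀ I : FairKCenter.Problem,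
      1 ≤ I.k → (∃ T, I.IsFair T) →
        I.SolvedBy P 3
          (C * ((I.k : ℝ) * I.n + (I.m : ℝ) ^ 2 * (I.k : ℝ) ^ 2 * Real.log I.k)) := by
  refine ⟨FairKCenter.fairProg, 2200, fun I hk hT => ?_⟩
  obtain ⟨t, s, he, ht, S, hout, happ⟩ := FairKCenter.fairProg_spec I hk hT
  refine ⟨t, s, S, he, ?_, hout, happ⟩
  obtain ⟨T₀, hT₀⟩ := hT
  have hC₀ := I.cover_of_isFair hk hT₀
  obtain ⟨x, hx⟩ := Finset.card_pos.1 (hk.trans hC₀.card_eq.ge)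
  have hx := Finset.mem_range.1 (hC₀.subset hx)
  have hcol := I.col_lt hx
  have hle := ht.trans (FairKCenter.total_time_le I hk (by omega) (by omega))
  have hle' : (t : ℝ) ≤ 500 * ((I.k : ℝ) * I.n) +
      ((if 2 ≤ I.k then 1100 * (I.m ^ 2 * I.k ^ 2) else 0 : ℕ) : ℝ) := by
    exact_mod_cast hle
  have hkn : (0 : ℝ) ≤ (I.k : ℝ) * I.n := by positivity
  have hmk : (0 : ℝ) ≤ (I.m : ℝ) ^ 2 * (I.k : ℝ) ^ 2 := by positivity
  split_ifs at hle' with h2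
  · push_cast at hle'
    -- The running time has no logarithm; `log k ≥ log 2 ≥ 1/2` pays for its appearance in the
    -- bound, which is why the constant is `2200 = 2 * 1100`.
    have hlog : (1 / 2 : ℝ) ≤ Real.log I.k := by
      have h₁ : Real.log 2 ≤ Real.log I.k :=
        Real.log_le_log (by norm_num) (by exact_mod_cast h2)
      linarith [Real.log_two_gt_d9]
    have := mul_le_mul_of_nonneg_left hlog hmk
    linarith
  · rw [show I.k = 1 by omega] at hle' hkn ⊢
    simp at hle' hkn ⊢
    linarith
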